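/- Let $\mathcal O=\mathbb R^8$ be the algebra of octonions, with standard basis $1,e_1,\dots,e_7$ (where $e_i^2=-1$, $e_ie_j=-e_je_i$ for $i\ne j$, and $e_ie_{i+1}=e_{i+3}$ together with its cyclic permutations, indices modulo $7$), and let $P_{24}$ be the cubic form on $\mathbb R^{24}=\mathcal O^3$ given by $P_{24}(o_1,o_2,o_3)=\operatorname{Re}\big((o_1\cdot o_2)\cdot o_3\big)$. Let $1\le\delta<2$ and let $H'\subset\mathbb R^{24}$ be a linear subspace of dimension $21$, identified with $\mathbb R^{21}$ by any linear isometry. Let $u$ be the restriction to $H'$ of the function $P_{24}(x)/|x|^{\delta}$ (with value $0$ at $x=0$). Then $u$ is a viscosity solution, in the open unit ball $B\subset\mathbb R^{21}$, of a uniformly elliptic Isaacs equation. That is, there are a constant $C>0$, nonempty sets of indices $a$ and $b$, and linear operators $L_{ab}=\sum_{i,j}a^{ab}_{ij}\,\partial^2/\partial x_i\partial x_j$ with constant symmetric coefficient matrices satisfying $$C^{-1}|\xi|^2\le\sum_{i,j}a^{ab}_{ij}\xi_i\xi_j\le C|\xi|^2\qquad\text{for all }\xi\in\mathbb R^{21}\text{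 and all }a,b,$$ such that $u$ is a viscosity solution in $B$ of $$\sup_b\inf_a L_{ab}u=0,$$ i.e. $u$ is continuous in $B$ and, for every $x_0\in B$ and every $\varphi\in C^2(B)$, one has $\sup_b\inf_a L_{ab}\varphi(x_0)\ge0$ if $u-\varphi$ has a local maximum at $x_0$, and $\sup_b\inf_a L_{ab}\varphi(x_0)\le0$ if $u-\varphi$ has a local minimum at $x_0$. -/

import Mathlib

/-- The space `ℝ²⁴ = 𝒪³` with its Euclidean structure: `x (j, i)` is the coordinate on the unit
`e_i` of the `j`-th octonion of `x` (with `e_0 = 1`). -/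
abbrev R24 : Type := EuclideanSpace ℝ (Fin 3 × Fin 8)

/-- The product of the octonions `∑ x i • e_i` and `∑ y i • e_i`, where `e_0 = 1`, the units
`e_1, …, e_7` square to `-1` and anticommute, and `e_i * e_{i+1} = e_{i+3}` together with its cyclic
permutations (indices modulo `7`). The quaternionic triples are
`124, 235, 346, 457, 561, 672, 713`. -/
def octMul (x y : Fin 8 → ℝ) : Fin 8 → ℝ :=
  ![x 0 * y 0 - x 1 * y 1 - x 2 * y 2 - x 3 * y 3 - x 4 * y 4 - x 5 * y 5 - x 6 * y 6 - x 7 * y 7,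
    x 0 * y 1 + x 1 * y 0 + (x 2 * y 4 - x 4 * y 2) + (x 3 * y 7 - x 7 * y 3)
      + (x 5 * y 6 - x 6 * y 5),
    x 0 * y 2 + x 2 * y 0 + (x 4 * y 1 - x 1 * y 4) + (x 3 * y 5 - x 5 * y 3)
      + (x 6 * y 7 - x 7 * y 6),
    x 0 * y 3 + x 3 * y 0 + (x 5 * y 2 - x 2 * y 5) + (x 4 * y 6 - x 6 * y 4)
      + (x 7 * y 1 - x 1 * y 7),
    x 0 * y 4 + x 4 * y 0 + (x 1 * y 2 - x 2 * y 1) + (x 6 * y 3 - x 3 * y 6)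
      + (x 5 * y 7 - x 7 * y 5),
    x 0 * y 5 + x 5 * y 0 + (x 2 * y 3 - x 3 * y 2) + (x 7 * y 4 - x 4 * y 7)
      + (x 6 * y 1 - x 1 * y 6),
    x 0 * y 6 + x 6 * y 0 + (x 3 * y 4 - x 4 * y 3) + (x 1 * y 5 - x 5 * y 1)
      + (x 7 * y 2 - x 2 * y 7),
    x 0 * y 7 + x 7 * y 0 + (x 4 * y 5 - x 5 * y 4) + (x 2 * y 6 - x 6 * y 2)
      + (x 1 * y 3 - x 3 * y 1)]

/-- The `j`-th octonion of a point of `ℝ²⁴ = 𝒪³`. -/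
def octPart (x : R24) (j : Fin 3) : Fin 8 → ℝ := fun i => x (j, i)

/-- The cubic form `P₂₄(o₁, o₂, o₃) = Re ((o₁ · o₂) · o₃)`. -/
def P24 (x : R24) : ℝ := octMul (octMul (octPart x 0) (octPart x 1)) (octPart x 2) 0

/-- The function `P₂₄(x) / |x| ^ δ`; Lean's conventions give it the value `0` at the origin, which
for `δ < 3` is its limit there. -/
noncomputable def w24 (δ : ℝ) (x : R24) : ℝ := P24 x / ‖x‖ ^ δ

/-- The Hessian matrix `(∂²φ/∂xᵢ∂xⱼ)(x)`. -/
noncomputable def hessianMatrix {n : ℕ} (φ : EuclideanSpace ℝ (Fin n) → ℝ)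
    (x : EuclideanSpace ℝ (Fin n)) : Matrix (Fin n) (Fin n) ℝ :=
  Matrix.of fun i j =>
    iteratedFDeriv ℝ 2 φ x ![EuclideanSpace.single i 1, EuclideanSpace.single j 1]

/-- `A` is symmetric and `C⁻¹ |ξ|² ≤ ∑ aᵢⱼ ξᵢ ξⱼ ≤ C |ξ|²` for all `ξ`. -/
def IsEllipticMatrix {n : ℕ} (C : ℝ) (A : Matrix (Fin n) (Fin n) ℝ) : Prop :=
  A.IsSymm ∧ ∀ ξ : Fin n → ℝ,
    C⁻¹ * ∑ i, ξ i ^ 2 ≤ ∑ i, ∑ j, A i j * ξ i * ξ j ∧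
      ∑ i, ∑ j, A i j * ξ i * ξ j ≤ C * ∑ i, ξ i ^ 2

/-- The Isaacs operator `F(M) = sup_b inf_a ∑ᵢⱼ (A a b)ᵢⱼ Mᵢⱼ`, so that
`F(D²u) = sup_b inf_a L_{ab} u` with `L_{ab} = ∑ᵢⱼ (A a b)ᵢⱼ ∂²/∂xᵢ∂xⱼ`. When the index sets are
nonempty and all `A a b` are elliptic with a common constant, all these suprema and infima are over
nonempty bounded sets of reals. -/
noncomputable def isaacsOperator {n : ℕ} {𝓐 𝓑 : Type} (A : 𝓐 → 𝓑 → Matrix (Fin n) (Fin n) ℝ)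
    (M : Matrix (Fin n) (Fin n) ℝ) : ℝ :=
  ⨆ b : 𝓑, ⨅ a : 𝓐, ∑ i, ∑ j, A a b i j * M i j

/-- `u` is a viscosity solution of `F(D²u) = 0` in the open set `Ω`, for `F` nondecreasing in the
Hessian: `u` is continuous in `Ω`, and at each `x₀ ∈ Ω` and for each `φ ∈ C²(Ω)`, if `u - φ` has a
local maximum at `x₀` then `F(D²φ(x₀)) ≥ 0`, and if it has a local minimum then
`F(D²φ(x₀)) ≤ 0`. -/
def IsViscositySolution {n : ℕ} (F : Matrix (Fin n) (Fin n) ℝ → ℝ)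
    (Ω : Set (EuclideanSpace ℝ (Fin n))) (u : EuclideanSpace ℝ (Fin n) → ℝ) : Prop :=
  ContinuousOn u Ω ∧
    ∀ x₀ ∈ Ω, ∀ φ : EuclideanSpace ℝ (Fin n) → ℝ, ContDiffOn ℝ 2 φ Ω →
      (IsLocalMax (fun x => u x - φ x) x₀ → 0 ≤ F (hessianMatrix φ x₀)) ∧
      (IsLocalMin (fun x => u x - φ x) x₀ → F (hessianMatrix φ x₀) ≤ 0)

/-- `u` is a viscosity solution in `Ω` of some uniformly elliptic Isaacs equation
`sup_b inf_a L_{ab} u = 0`: the `L_{ab}` are linear operators with constant coefficients and a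
common ellipticity constant. -/
def SolvesUniformlyEllipticIsaacs {n : ℕ} (Ω : Set (EuclideanSpace ℝ (Fin n)))
    (u : EuclideanSpace ℝ (Fin n) → ℝ) : Prop :=
  ∃ (𝓐 𝓑 : Type) (_ : Nonempty 𝓐) (_ : Nonempty 𝓑) (A : 𝓐 → 𝓑 → Matrix (Fin n) (Fin n) ℝ) (C : ℝ),
    0 < C ∧ (∀ a b, IsEllipticMatrix C (A a b)) ∧ IsViscositySolution (isaacsOperator A) Ω u

/-! Let `M_x` be the restriction to `H` of `w24Form δ x`, a positive multiple of the Hessian of `w24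
δ` at `x ≠ 0`. It suffices to find, for all nonzero `b`, `c`, a matrix `A_{bc}`, elliptic with a
common constant, such that `⟨A_{bc}, M_b⟩ ≥ 0 ≥ ⟨A_{bc}, M_c⟩`. The equation is then `sup_b inf_a
⟨A_{ba}, D²u⟩ = 0`: at a point `x ≠ 0` the choice `b = x` makes the supremum nonnegative and the
choice `a = x` makes every infimum nonpositive. At the origin `u` is odd, so a test function
touching it there has a semidefinite Hessian.

By Hahn–Banach in the plane (`exists_isEllipticMatrix_separating`), `A_{bc}` exists once every `t
M_b - (1 - t) M_c`, `0 ≤ t ≤ 1`, pairs nonnegatively with some elliptic matrix. For unit `b`, `c`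
put `d = t b - (1 - t) c`. The trace of the combination is `O(|d|)`, so `1 + k v vᵀ` serves as soon
as the combination is at least `κ |d|` at a unit vector `v` of `H`
(`exists_w24Form_combination_ge`).

For `v` orthogonal to `b` and `c` that value is `t P24Polar b v v - (1 - t) P24Polar c v v - δ p`
with `p = t P24 b - (1 - t) P24 c`. If `p ≤ |d| / (2√3)`, the first two terms form the Hessian of
`P24` at `d`, which is at least `|d| / √3` on a large subspace. Otherwise they can be made at least
`2 p - ε`, and `δ < 2` gives the gain.

Both estimates rest on `P24Polar_sub_eq`: by the composition and Moufang identities, eliminating the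
last two octonions from the Hessian at a unit vector `a`, shifted by `l`, leaves a scalar multiple
of `l³ - l + 2 P24 a` on the first one. Bounds by roots of this cubic therefore hold on subspaces of
codimension `17` or `9`, and all conditions imposed on `v`, including the two orthogonality
relations, number at most `20 < 21`. -/

/-! ### Octonion identities -/

/-- The conjugate of an octonion. -/
def octConj (x : Fin 8 → ℝ) : Fin 8 → ℝ :=
  ![x 0, -x 1, -x 2, -x 3, -x 4, -x 5, -x 6, -x 7]

/-- The trilinear form `Re ((x · y) · z)`. -/
def octTriple (x y z : Fin 8 → ℝ) : ℝ := octMul (octMul x y) z 0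

theorem octConj_add (x y : Fin 8 → ℝ) : octConj (x + y) = octConj x + octConj y := by
  ext i; fin_cases i <;> simp [octConj] <;> ring

theorem octConj_smul (c : ℝ) (x : Fin 8 → ℝ) : octConj (c • x) = c • octConj x := by
  ext i; fin_cases i <;> simp [octConj]

theorem octMul_add (x y z : Fin 8 → ℝ) : octMul x (y + z) = octMul x y + octMul x z := by
  ext i; fin_cases i <;> simp [octMul] <;> ring

theorem add_octMul (x y z : Fin 8 → ℝ) : octMul (x + y) z = octMul x z + octMul y z := by
  ext i; fin_cases i <;> simp [octMul] <;> ring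

theorem octMul_smul (c : ℝ) (x y : Fin 8 → ℝ) : octMul x (c • y) = c • octMul x y := by
  ext i; fin_cases i <;> simp [octMul] <;> ring

theorem smul_octMul (c : ℝ) (x y : Fin 8 → ℝ) : octMul (c • x) y = c • octMul x y := by
  ext i; fin_cases i <;> simp [octMul] <;> ring

theorem octConj_octConj (x : Fin 8 → ℝ) : octConj (octConj x) = x := by
  ext i; fin_cases i <;> simp [octConj]

theorem octConj_dotProduct_octConj (x y : Fin 8 → ℝ) : octConj x ⬝ᵥ octConj y = x ⬝ᵥ y := by
  simp [octConj, dotProduct, Fin.sum_univ_eight]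

theorem octMul_dotProduct_self (x y : Fin 8 → ℝ) :
    octMul x y ⬝ᵥ octMul x y = (x ⬝ᵥ x) * (y ⬝ᵥ y) := by
  simp [octMul, dotProduct, Fin.sum_univ_eight]; ring

theorem octConj_octMul (x y : Fin 8 → ℝ) :
    octConj (octMul x y) = octMul (octConj y) (octConj x) := by
  ext i; fin_cases i <;> simp [octMul, octConj] <;> ring

/-- Alternativity in inverse form. With the mirror identity below it makes `octPairing a` and
`octPairingT a` inverse to each other up to the factor `|a|²`. -/
theorem octMul_octMul_octConj (x y : Fin 8 → ℝ) :
    octMul (octMul y (octConj x)) x = (x ⬝ᵥ x) • y := by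
  ext i; fin_cases i <;> simp [octMul, octConj, dotProduct, Fin.sum_univ_eight] <;> ring

theorem octMul_octConj_octMul (x y : Fin 8 → ℝ) :
    octMul x (octMul (octConj x) y) = (x ⬝ᵥ x) • y := by
  ext i; fin_cases i <;> simp [octMul, octConj, dotProduct, Fin.sum_univ_eight] <;> ring

theorem octTriple_eq_left (x y z : Fin 8 → ℝ) :
    octTriple x y z = x ⬝ᵥ octConj (octMul y z) := by
  simp [octTriple, octMul, octConj, dotProduct, Fin.sum_univ_eight]; ring

theorem octTriple_eq_mid (x y z : Fin 8 → ℝ) :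
    octTriple x y z = y ⬝ᵥ octConj (octMul z x) := by
  simp [octTriple, octMul, octConj, dotProduct, Fin.sum_univ_eight]; ring

theorem octTriple_eq_right (x y z : Fin 8 → ℝ) :
    octTriple x y z = z ⬝ᵥ octConj (octMul x y) := by
  simp [octTriple, octMul, octConj, dotProduct, Fin.sum_univ_eight]; ring

/-- The middle Moufang identity, with the product `w · (x · y) · w` written out. -/
theorem octMul_moufang (w x y : Fin 8 → ℝ) :
    octMul (octMul w x) (octMul y w) =
      (2 * octTriple w x y) • w - (w ⬝ᵥ w) • octConj (octMul x y) := by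
  ext i; fin_cases i <;>
    simp [octTriple, octMul, octConj, dotProduct, Fin.sum_univ_eight] <;> ring

theorem octTriple_add_left (x x' y z : Fin 8 → ℝ) :
    octTriple (x + x') y z = octTriple x y z + octTriple x' y z := by
  simp [octTriple, add_octMul]

theorem octTriple_add_mid (x y y' z : Fin 8 → ℝ) :
    octTriple x (y + y') z = octTriple x y z + octTriple x y' z := by
  simp [octTriple, add_octMul, octMul_add]

theorem octTriple_add_right (x y z z' : Fin 8 → ℝ) :
    octTriple x y (z + z') = octTriple x y z + octTriple x y z' := by
  simp [octTriple, octMul_add]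

theorem octTriple_smul_left (c : ℝ) (x y z : Fin 8 → ℝ) :
    octTriple (c • x) y z = c * octTriple x y z := by
  simp [octTriple, smul_octMul]

theorem octTriple_smul_mid (c : ℝ) (x y z : Fin 8 → ℝ) :
    octTriple x (c • y) z = c * octTriple x y z := by
  simp [octTriple, smul_octMul, octMul_smul]

theorem octTriple_smul_right (c : ℝ) (x y z : Fin 8 → ℝ) :
    octTriple x y (c • z) = c * octTriple x y z := by
  simp [octTriple, octMul_smul]

/-! ### The polarization of the cubic form -/

/-- The symmetric trilinear form with `P24Polar x x x = 6 * P24 x`; as a function of `y` and `z` it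
is the Hessian of `P24` at `x`. -/
def P24Polar (x y z : R24) : ℝ :=
  octTriple (octPart x 0) (octPart y 1) (octPart z 2)
    + octTriple (octPart x 0) (octPart z 1) (octPart y 2)
    + octTriple (octPart y 0) (octPart x 1) (octPart z 2)
    + octTriple (octPart z 0) (octPart x 1) (octPart y 2)
    + octTriple (octPart y 0) (octPart z 1) (octPart x 2)
    + octTriple (octPart z 0) (octPart y 1) (octPart x 2)

theorem octPart_add (x y : R24) (j : Fin 3) : octPart (x + y) j = octPart x j + octPart y j := rfl

theorem octPart_smul (c : ℝ) (x : R24) (j : Fin 3) : octPart (c • x) j = c • octPart x j := rfl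

theorem P24Polar_swap_right (x y z : R24) : P24Polar x y z = P24Polar x z y := by
  simp only [P24Polar]; ring

theorem P24Polar_swap_left (x y z : R24) : P24Polar x y z = P24Polar y x z := by
  simp only [P24Polar]; ring

theorem P24Polar_add_left (x x' y z : R24) :
    P24Polar (x + x') y z = P24Polar x y z + P24Polar x' y z := by
  simp only [P24Polar, octPart_add, octTriple_add_left, octTriple_add_mid, octTriple_add_right]
  ring

theorem P24Polar_smul_left (c : ℝ) (x y z : R24) :
    P24Polar (c • x) y z = c * P24Polar x y z := by
  simp only [P24Polar, octPart_smul, octTriple_smul_left, octTriple_smul_mid, octTriple_smul_right]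
  ring

theorem P24Polar_add_mid (x y y' z : R24) :
    P24Polar x (y + y') z = P24Polar x y z + P24Polar x y' z := by
  rw [P24Polar_swap_left, P24Polar_add_left, P24Polar_swap_left y, P24Polar_swap_left y']

theorem P24Polar_smul_mid (c : ℝ) (x y z : R24) :
    P24Polar x (c • y) z = c * P24Polar x y z := by
  rw [P24Polar_swap_left, P24Polar_smul_left, P24Polar_swap_left y]

theorem P24Polar_add_right (x y z z' : R24) :
    P24Polar x y (z + z') = P24Polar x y z + P24Polar x y z' := by
  rw [P24Polar_swap_right, P24Polar_add_mid, P24Polar_swap_right x z, P24Polar_swap_right x z']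

theorem P24Polar_smul_right (c : ℝ) (x y z : R24) :
    P24Polar x y (c • z) = c * P24Polar x y z := by
  rw [P24Polar_swap_right, P24Polar_smul_mid, P24Polar_swap_right x z]

theorem P24_eq_octTriple (x : R24) :
    P24 x = octTriple (octPart x 0) (octPart x 1) (octPart x 2) := rfl

theorem P24Polar_self (x : R24) : P24Polar x x x = 6 * P24 x := by
  simp only [P24Polar, P24_eq_octTriple]; ring

theorem P24Polar_diag (a v : R24) :
    P24Polar a v v = 2 * (octTriple (octPart a 0) (octPart v 1) (octPart v 2)
      + octTriple (octPart v 0) (octPart a 1) (octPart v 2)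
      + octTriple (octPart v 0) (octPart v 1) (octPart a 2)) := by
  simp only [P24Polar]; ring

theorem P24_smul (c : ℝ) (x : R24) : P24 (c • x) = c ^ 3 * P24 x := by
  simp only [P24_eq_octTriple, octPart_smul, octTriple_smul_left, octTriple_smul_mid,
    octTriple_smul_right]
  ring

theorem norm_sq_eq_octPart (v : R24) :
    ‖v‖ ^ 2 = octPart v 0 ⬝ᵥ octPart v 0 + octPart v 1 ⬝ᵥ octPart v 1
      + octPart v 2 ⬝ᵥ octPart v 2 := by
  rw [EuclideanSpace.real_norm_sq_eq, Fintype.sum_prod_type, Fin.sum_univ_three]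
  simp [dotProduct, octPart, sq]

theorem dotProduct_self_nonneg_real (x : Fin 8 → ℝ) : 0 ≤ x ⬝ᵥ x :=
  Finset.sum_nonneg fun i _ => mul_self_nonneg (x i)

/-! ### Multiplication operators as scaled isometries -/

/-- The operators `v ↦ conj (a · v)` representing `Re ((a · v) · z)` as an inner product. -/
def octPairing (a : Fin 8 → ℝ) : (Fin 8 → ℝ) →ₗ[ℝ] (Fin 8 → ℝ) where
  toFun v := octConj (octMul a v)
  map_add' v w := by rw [octMul_add, octConj_add]
  map_smul' c v := by rw [octMul_smul, octConj_smul, RingHom.id_apply]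

/-- The transpose of `octPairing a`. -/
def octPairingT (a : Fin 8 → ℝ) : (Fin 8 → ℝ) →ₗ[ℝ] (Fin 8 → ℝ) where
  toFun v := octConj (octMul v a)
  map_add' v w := by rw [add_octMul, octConj_add]
  map_smul' c v := by rw [smul_octMul, octConj_smul, RingHom.id_apply]

theorem octPairing_apply (a v : Fin 8 → ℝ) : octPairing a v = octConj (octMul a v) := rfl

theorem octPairingT_apply (a v : Fin 8 → ℝ) : octPairingT a v = octConj (octMul v a) := rfl

theorem octTriple_eq_octPairing (a v z : Fin 8 → ℝ) :
    octTriple a v z = octPairing a v ⬝ᵥ z := by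
  rw [octTriple_eq_right, dotProduct_comm, octPairing_apply]

theorem octPairing_dotProduct (a v z : Fin 8 → ℝ) :
    octPairing a v ⬝ᵥ z = v ⬝ᵥ octPairingT a z := by
  rw [← octTriple_eq_octPairing, octTriple_eq_mid, octPairingT_apply]

theorem octPairing_octPairingT (a v : Fin 8 → ℝ) :
    octPairing a (octPairingT a v) = (a ⬝ᵥ a) • v := by
  have h := octMul_octMul_octConj (octConj a) v
  rw [octConj_octConj, octConj_dotProduct_octConj] at h
  rw [octPairing_apply, octPairingT_apply, octConj_octMul, octConj_octConj, h]

theorem octPairingT_octPairing (a v : Fin 8 → ℝ) :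
    octPairingT a (octPairing a v) = (a ⬝ᵥ a) • v := by
  have h := octMul_octConj_octMul (octConj a) v
  rw [octConj_octConj, octConj_dotProduct_octConj] at h
  rw [octPairing_apply, octPairingT_apply, octConj_octMul, octConj_octConj, h]

theorem octPairing_dotProduct_octPairing (a v : Fin 8 → ℝ) :
    octPairing a v ⬝ᵥ octPairing a v = (a ⬝ᵥ a) * (v ⬝ᵥ v) := by
  rw [octPairing_apply, octConj_dotProduct_octConj, octMul_dotProduct_self]

/-- `octPairing a` is `|a|` times an isometry, so expanding `|octPairing a p ± |a| q|² ≥ 0` gives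
both signs. -/
theorem abs_two_mul_octPairing_le (a p q : Fin 8 → ℝ) :
    |2 * (octPairing a p ⬝ᵥ q)| ≤ √(a ⬝ᵥ a) * (p ⬝ᵥ p + q ⬝ᵥ q) := by
  have ha := dotProduct_self_nonneg_real a
  set x := √(a ⬝ᵥ a) with hx
  have hx0 : 0 ≤ x := Real.sqrt_nonneg _
  have hxx : a ⬝ᵥ a = x ^ 2 := (Real.sq_sqrt ha).symm
  have hJ := octPairing_dotProduct_octPairing a p
  have key : ∀ s : ℝ, 0 ≤ x ^ 2 * (p ⬝ᵥ p) + s ^ 2 * (q ⬝ᵥ q)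
      + 2 * s * (octPairing a p ⬝ᵥ q) := by
    intro s
    have h := dotProduct_self_nonneg_real (octPairing a p + s • q)
    simp only [add_dotProduct, dotProduct_add, smul_dotProduct, dotProduct_smul, hJ, hxx,
      smul_eq_mul, dotProduct_comm q] at h
    linarith
  have hq := dotProduct_self_nonneg_real q
  rcases hx0.eq_or_lt with h0 | h0
  · rw [← h0] at key ⊢
    have h3 : octPairing a p ⬝ᵥ q = 0 := by
      have hz : octPairing a p = 0 := by
        rw [← dotProduct_self_eq_zero, hJ, hxx, ← h0]; ring
      rw [hz, zero_dotProduct]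
    rw [h3]; simp
  · rw [abs_le]
    have h1 := key x
    have h2 := key (-x)
    constructor
    · refine le_of_mul_le_mul_left ?_ h0; nlinarith
    · refine le_of_mul_le_mul_left ?_ h0; nlinarith

/-- The cyclic product identity coming from the middle Moufang identity. -/
theorem octPairing_dotProduct_moufang (a b c w : Fin 8 → ℝ) :
    octPairing a (octConj (octMul c w)) ⬝ᵥ octConj (octMul w b) =
      2 * octTriple w b c * (w ⬝ᵥ a) - (w ⬝ᵥ w) * octTriple a b c := by
  rw [← octTriple_eq_octPairing, octTriple_eq_left, octConj_octMul, octConj_octConj,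
    octConj_octConj, octMul_moufang, dotProduct_sub, dotProduct_smul, dotProduct_smul,
    octTriple_eq_left a b c, smul_eq_mul, smul_eq_mul, dotProduct_comm a w]

/-! ### The Schur complement of the shifted Hessian -/

/-- Completing the square around a critical point `(P, Q)`. -/
theorem octPairing_complete_square (a f g P Q p q : Fin 8 → ℝ) (l : ℝ)
    (hQ : octPairing a P + f = l • Q) (hP : octPairingT a Q + g = l • P) :
    2 * (octPairing a (P + p) ⬝ᵥ (Q + q) + f ⬝ᵥ (Q + q) + g ⬝ᵥ (P + p))
        - l * ((P + p) ⬝ᵥ (P + p) + (Q + q) ⬝ᵥ (Q + q)) =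
      f ⬝ᵥ Q + g ⬝ᵥ P + 2 * (octPairing a p ⬝ᵥ q) - l * (p ⬝ᵥ p + q ⬝ᵥ q) := by
  have hf : f = l • Q - octPairing a P := eq_sub_of_add_eq' hQ
  have hg : g = l • P - octPairingT a Q := eq_sub_of_add_eq' hP
  have h1 := octPairing_dotProduct a p Q
  have h2 := octPairing_dotProduct a P Q
  subst hf hg
  simp only [map_add, add_dotProduct, dotProduct_add, sub_dotProduct, smul_dotProduct, smul_eq_mul,
    h1, h2, dotProduct_comm (octPairingT a Q), dotProduct_comm q Q, dotProduct_comm p P]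
  ring

/-- The coordinates of the critical point used to eliminate the second and third octonion. -/
noncomputable def critMid (a : R24) (l : ℝ) (w : Fin 8 → ℝ) : Fin 8 → ℝ :=
  (l ^ 2 - octPart a 0 ⬝ᵥ octPart a 0)⁻¹ • (l • octConj (octMul (octPart a 2) w)
    + octPairingT (octPart a 0) (octConj (octMul w (octPart a 1))))

/-- See `critMid`. -/
noncomputable def critRight (a : R24) (l : ℝ) (w : Fin 8 → ℝ) : Fin 8 → ℝ :=
  (l ^ 2 - octPart a 0 ⬝ᵥ octPart a 0)⁻¹ • (l • octConj (octMul w (octPart a 1))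
    + octPairing (octPart a 0) (octConj (octMul (octPart a 2) w)))

/-- For fixed first octonion `w` the form is quadratic in the other two, with a block of eigenvalues
`±|a₀| - l`, invertible when `l² ≠ |a₀|²`. Completing the square at its critical point leaves a form
in `w` alone. -/
theorem P24Polar_sub_eq (a v : R24) (l : ℝ) (ha : ‖a‖ = 1)
    (hl : l ^ 2 - octPart a 0 ⬝ᵥ octPart a 0 ≠ 0)
    (hv : octPart v 0 ⬝ᵥ octPart a 0 = 0) :
    P24Polar a v v - l * ‖v‖ ^ 2 =
      -((l ^ 2 - octPart a 0 ⬝ᵥ octPart a 0)⁻¹ * (l ^ 3 - l + 2 * P24 a)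
        * (octPart v 0 ⬝ᵥ octPart v 0))
      + 2 * (octPairing (octPart a 0) (octPart v 1 - critMid a l (octPart v 0))
        ⬝ᵥ (octPart v 2 - critRight a l (octPart v 0)))
      - l * ((octPart v 1 - critMid a l (octPart v 0))
          ⬝ᵥ (octPart v 1 - critMid a l (octPart v 0))
        + (octPart v 2 - critRight a l (octPart v 0))
          ⬝ᵥ (octPart v 2 - critRight a l (octPart v 0))) := by
  have hn := norm_sq_eq_octPart a
  rw [ha] at hn
  rw [P24Polar_diag, norm_sq_eq_octPart, P24_eq_octTriple]
  -- Orthogonality of `w` to `a₀` kills the first Moufang term, so the only cross term is `-|w|² P24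
  -- a` and the remaining form is a multiple of `|w|²`.
  have hmouf := octPairing_dotProduct_moufang (octPart a 0) (octPart a 1) (octPart a 2) (octPart v 0)
  rw [hv] at hmouf
  unfold critMid critRight
  generalize octPart v 0 = w at *
  generalize octPart v 1 = v1
  generalize octPart v 2 = v2
  generalize octPart a 0 = a0 at *
  generalize octPart a 1 = a1 at *
  generalize octPart a 2 = a2 at *
  have hD : l ^ 2 - a0 ⬝ᵥ a0 ≠ 0 := hl
  have hff : octConj (octMul w a1) ⬝ᵥ octConj (octMul w a1) = (w ⬝ᵥ w) * (a1 ⬝ᵥ a1) := by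
    rw [octConj_dotProduct_octConj, octMul_dotProduct_self]
  have hgg : octConj (octMul a2 w) ⬝ᵥ octConj (octMul a2 w) = (a2 ⬝ᵥ a2) * (w ⬝ᵥ w) := by
    rw [octConj_dotProduct_octConj, octMul_dotProduct_self]
  have e1 : octTriple w a1 v2 = octConj (octMul w a1) ⬝ᵥ v2 := by
    rw [octTriple_eq_right, dotProduct_comm]
  have e2 : octTriple w v1 a2 = octConj (octMul a2 w) ⬝ᵥ v1 := by
    rw [octTriple_eq_mid, dotProduct_comm]
  rw [e1, e2, octTriple_eq_octPairing a0 v1]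
  generalize octConj (octMul w a1) = f at *
  generalize octConj (octMul a2 w) = g at *
  set P := (l ^ 2 - a0 ⬝ᵥ a0)⁻¹ • (l • g + octPairingT a0 f) with hPdef
  set Q := (l ^ 2 - a0 ⬝ᵥ a0)⁻¹ • (l • f + octPairing a0 g) with hQdef
  have hQ : octPairing a0 P + f = l • Q := by
    rw [hPdef, hQdef, map_smul, map_add, map_smul, octPairing_octPairingT]
    ext i
    simp only [Pi.add_apply, Pi.smul_apply, smul_eq_mul]
    field_simp; ring
  have hP : octPairingT a0 Q + g = l • P := by
    rw [hPdef, hQdef, map_smul, map_add, map_smul, octPairingT_octPairing]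
    ext i
    simp only [Pi.add_apply, Pi.smul_apply, smul_eq_mul]
    field_simp; ring
  have hsq := octPairing_complete_square a0 f g P Q (v1 - P) (v2 - Q) l hQ hP
  rw [add_sub_cancel, add_sub_cancel] at hsq
  have hcrit : f ⬝ᵥ Q + g ⬝ᵥ P = (l ^ 2 - a0 ⬝ᵥ a0)⁻¹
      * (l * (f ⬝ᵥ f + g ⬝ᵥ g) + 2 * (octPairing a0 g ⬝ᵥ f)) := by
    rw [hPdef, hQdef]
    simp only [dotProduct_smul, dotProduct_add, smul_eq_mul, dotProduct_comm f (octPairing a0 g),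
      ← octPairing_dotProduct]
    ring
  have hval : f ⬝ᵥ Q + g ⬝ᵥ P - l * (w ⬝ᵥ w) =
      -((l ^ 2 - a0 ⬝ᵥ a0)⁻¹ * (l ^ 3 - l + 2 * octTriple a0 a1 a2) * (w ⬝ᵥ w)) := by
    rw [hcrit, hff, hgg, hmouf]
    have : a2 ⬝ᵥ a2 = 1 - a0 ⬝ᵥ a0 - a1 ⬝ᵥ a1 := by linarith
    rw [this]
    field_simp; ring
  linarith

/-- `octPart · j` as a linear map. -/
def octPartLinear (j : Fin 3) : R24 →ₗ[ℝ] (Fin 8 → ℝ) where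
  toFun v := octPart v j
  map_add' _ _ := rfl
  map_smul' _ _ := rfl

/-- The pairing of the first octonion with `a` as a linear functional. -/
noncomputable def firstPairing (a : Fin 8 → ℝ) : R24 →ₗ[ℝ] ℝ where
  toFun v := octPart v 0 ⬝ᵥ a
  map_add' v w := by rw [octPart_add, add_dotProduct]
  map_smul' c v := by rw [octPart_smul, smul_dotProduct, RingHom.id_apply]

/-- `critMid a l` as a linear map. -/
noncomputable def critMidLinear (a : R24) (l : ℝ) : (Fin 8 → ℝ) →ₗ[ℝ] (Fin 8 → ℝ) where
  toFun := critMid a l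
  map_add' v w := by
    simp only [critMid, octMul_add, add_octMul, octConj_add, map_add, smul_add]; abel
  map_smul' c v := by
    simp only [critMid, octMul_smul, smul_octMul, octConj_smul, map_smul, smul_add, RingHom.id_apply]
    simp only [smul_smul, mul_comm, mul_left_comm, mul_assoc]

/-- `critRight a l` as a linear map. -/
noncomputable def critRightLinear (a : R24) (l : ℝ) : (Fin 8 → ℝ) →ₗ[ℝ] (Fin 8 → ℝ) where
  toFun := critRight a l
  map_add' v w := by
    simp only [critRight, octMul_add, add_octMul, octConj_add, map_add, smul_add]; abel
  map_smul' c v := by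
    simp only [critRight, octMul_smul, smul_octMul, octConj_smul, map_smul, smul_add,
      RingHom.id_apply]
    simp only [smul_smul, mul_comm, mul_left_comm, mul_assoc]

/-! ### Bounds for the Hessian of the cubic form on subspaces -/

/-- The norm of the first octonion. -/
noncomputable def firstNorm (a : R24) : ℝ := √(octPart a 0 ⬝ᵥ octPart a 0)

theorem firstNorm_nonneg (a : R24) : 0 ≤ firstNorm a := Real.sqrt_nonneg _

theorem firstNorm_sq (a : R24) : octPart a 0 ⬝ᵥ octPart a 0 = firstNorm a ^ 2 :=
  (Real.sq_sqrt (dotProduct_self_nonneg_real _)).symm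

/-- For a unit vector this says that `x³ - x ± 2 P24 a ≤ 0` at `x = firstNorm a`, which locates
`firstNorm a` relative to the roots of the cubic. -/
theorem abs_two_mul_P24_le (a : R24) :
    |2 * P24 a| ≤ firstNorm a * (‖a‖ ^ 2 - firstNorm a ^ 2) := by
  have h := abs_two_mul_octPairing_le (octPart a 0) (octPart a 1) (octPart a 2)
  rw [← octTriple_eq_octPairing, ← P24_eq_octTriple] at h
  have hn := norm_sq_eq_octPart a
  rw [firstNorm_sq] at hn
  calc _ ≤ _ := h
    _ = _ := by rw [hn, firstNorm]; ring

theorem firstNorm_le (a : R24) : firstNorm a ≤ ‖a‖ := by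
  refine le_of_sq_le_sq ?_ (norm_nonneg a)
  rw [norm_sq_eq_octPart, firstNorm_sq]
  have h1 := dotProduct_self_nonneg_real (octPart a 1)
  have h2 := dotProduct_self_nonneg_real (octPart a 2)
  linarith

/-- Above `firstNorm a` the eliminated block is negative, and the Schur complement is nonpositive by
the sign of the cubic; only one linear condition is spent. -/
theorem P24Polar_le_of_pairing_eq_zero (a : R24) (ha : ‖a‖ = 1) (l : ℝ) (hl : firstNorm a < l)
    (h : 0 ≤ l ^ 3 - l + 2 * P24 a) (v : R24) (hv : firstPairing (octPart a 0) v = 0) :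
    P24Polar a v v ≤ l * ‖v‖ ^ 2 := by
  have hx := firstNorm_nonneg a
  have hD : 0 < l ^ 2 - octPart a 0 ⬝ᵥ octPart a 0 := by rw [firstNorm_sq]; nlinarith
  have key := P24Polar_sub_eq a v l ha hD.ne' hv
  have hb := (abs_le.1 (abs_two_mul_octPairing_le (octPart a 0)
    (octPart v 1 - critMid a l (octPart v 0)) (octPart v 2 - critRight a l (octPart v 0)))).2
  have hp := dotProduct_self_nonneg_real (octPart v 1 - critMid a l (octPart v 0))
  have hq := dotProduct_self_nonneg_real (octPart v 2 - critRight a l (octPart v 0))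
  have h1 := mul_nonneg (mul_nonneg (inv_pos.2 hD).le h) (dotProduct_self_nonneg_real (octPart v 0))
  have h2 := mul_le_mul_of_nonneg_right hl.le (add_nonneg hp hq)
  rw [← firstNorm] at hb
  linarith

theorem P24Polar_of_first_eq_zero (a v : R24) (hv : octPart v 0 = 0) :
    P24Polar a v v = 2 * (octPairing (octPart a 0) (octPart v 1) ⬝ᵥ octPart v 2) := by
  have h0 : (0 : Fin 8 → ℝ) = (0 : ℝ) • (0 : Fin 8 → ℝ) := by simp
  rw [P24Polar_diag, hv, octTriple_eq_octPairing (octPart a 0)]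
  conv_lhs => rw [h0, octTriple_smul_left, octTriple_smul_left]
  ring

/-- `P24Polar a` is at least `l` on a subspace of codimension at most `17`. -/
theorem exists_le_P24Polar_codim_seventeen (a : R24) (ha : ‖a‖ = 1) (l : ℝ)
    (h : l ^ 3 - l + 2 * P24 a ≤ 0) :
    ∃ L : R24 →ₗ[ℝ] ((Fin 8 → ℝ) × (Fin 8 → ℝ) × ℝ), ∀ v, L v = 0 →
      l * ‖v‖ ^ 2 ≤ P24Polar a v v := by
  have hx := firstNorm_nonneg a
  rcases lt_or_ge (firstNorm a) l with hl | hl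
  · have hD : 0 < l ^ 2 - octPart a 0 ⬝ᵥ octPart a 0 := by rw [firstNorm_sq]; nlinarith
    -- The subspace is the graph of the critical point over the vectors orthogonal to `a₀`; only the
    -- Schur complement survives there.
    refine ⟨(octPartLinear 1 - critMidLinear a l ∘ₗ octPartLinear 0).prod
      ((octPartLinear 2 - critRightLinear a l ∘ₗ octPartLinear 0).prod
        (firstPairing (octPart a 0))), fun v hv => ?_⟩
    have h1 : octPart v 1 - critMid a l (octPart v 0) = 0 := congrArg Prod.fst hv
    have h2 : octPart v 2 - critRight a l (octPart v 0) = 0 := congrArg (fun z => z.2.1) hv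
    have h3 : octPart v 0 ⬝ᵥ octPart a 0 = 0 := congrArg (fun z => z.2.2) hv
    have key := P24Polar_sub_eq a v l ha hD.ne' h3
    rw [h1, h2, map_zero, zero_dotProduct] at key
    have h4 := mul_nonneg (mul_nonneg (inv_pos.2 hD).le (neg_nonneg.2 h))
      (dotProduct_self_nonneg_real (octPart v 0))
    linarith
  -- With vanishing first octonion, the top eigenspace of the block, `v₂ = octPairing a₀ v₁ / |a₀|`,
  -- has eigenvalue `|a₀| ≥ l`. When `a₀ = 0` the form vanishes and `l ≤ 0`.
  · refine ⟨(octPartLinear 0).prod ((firstNorm a • octPartLinear 2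
      - octPairing (octPart a 0) ∘ₗ octPartLinear 1
      + (if firstNorm a = 0 then octPartLinear 2 else 0)).prod 0), fun v hv => ?_⟩
    have h1' : octPart v 0 = 0 := congrArg Prod.fst hv
    have h2 : firstNorm a • octPart v 2 - octPairing (octPart a 0) (octPart v 1)
        + (if firstNorm a = 0 then octPartLinear 2 else 0 : R24 →ₗ[ℝ] (Fin 8 → ℝ)) v = 0 :=
      congrArg (fun z => z.2.1) hv
    rw [norm_sq_eq_octPart, P24Polar_of_first_eq_zero a v h1', h1', zero_dotProduct]
    have hJ := octPairing_dotProduct_octPairing (octPart a 0) (octPart v 1)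
    rw [firstNorm_sq] at hJ
    have hp := dotProduct_self_nonneg_real (octPart v 1)
    have hq := dotProduct_self_nonneg_real (octPart v 2)
    split_ifs at h2 with h0
    · rw [h0] at h2 hJ hl
      have hz : octPairing (octPart a 0) (octPart v 1) = 0 := by
        rw [← dotProduct_self_eq_zero, hJ]; ring
      rw [hz, zero_dotProduct]
      nlinarith
    · have h2' : octPairing (octPart a 0) (octPart v 1) = firstNorm a • octPart v 2 := by
        rw [LinearMap.zero_apply, add_zero] at h2
        exact (sub_eq_zero.1 h2).symm
      have hpos : 0 < firstNorm a := lt_of_le_of_ne hx (Ne.symm h0)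
      rw [h2'] at hJ ⊢
      simp only [smul_dotProduct, dotProduct_smul, smul_eq_mul] at hJ ⊢
      have : octPart v 1 ⬝ᵥ octPart v 1 = octPart v 2 ⬝ᵥ octPart v 2 := by
        have := mul_left_cancel₀ (pow_ne_zero 2 h0)
          ((by linarith : firstNorm a ^ 2 * (octPart v 2 ⬝ᵥ octPart v 2)
            = firstNorm a ^ 2 * (octPart v 1 ⬝ᵥ octPart v 1)))
        exact this.symm
      rw [this]
      nlinarith

/-- `P24Polar a` is at least `l` on a subspace of codimension at most `9`. -/
theorem exists_le_P24Polar_codim_nine (a : R24) (ha : ‖a‖ = 1) (l : ℝ) (hl : l < firstNorm a)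
    (h : 0 ≤ l ^ 3 - l + 2 * P24 a) :
    ∃ L : R24 →ₗ[ℝ] ((Fin 8 → ℝ) × ℝ), ∀ v, L v = 0 → l * ‖v‖ ^ 2 ≤ P24Polar a v v := by
  have hx := firstNorm_nonneg a
  rcases le_or_gt l (-firstNorm a) with hl' | hl'
  -- Here `l` lies below the whole spectrum `±|a₀|` of the block, so vanishing of the first octonion
  -- is enough.
  · refine ⟨(octPartLinear 0).prod 0, fun v hv => ?_⟩
    have h1' : octPart v 0 = 0 := congrArg Prod.fst hv
    rw [norm_sq_eq_octPart, P24Polar_of_first_eq_zero a v h1', h1', zero_dotProduct]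
    have hb := (abs_le.1 (abs_two_mul_octPairing_le (octPart a 0) (octPart v 1) (octPart v 2))).1
    have hp := dotProduct_self_nonneg_real (octPart v 1)
    have hq := dotProduct_self_nonneg_real (octPart v 2)
    rw [← firstNorm] at hb
    nlinarith
  · have hpos : 0 < firstNorm a := by linarith
    have hD : l ^ 2 - octPart a 0 ⬝ᵥ octPart a 0 < 0 := by rw [firstNorm_sq]; nlinarith
    -- For `|l| < |a₀|` the denominator `l² - |a₀|²` is negative, so a nonnegative cubic makes the
    -- Schur complement nonnegative. The deviation from the critical point is confined to the top
    -- eigenspace of the block, at a cost of `8` conditions.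
    refine ⟨(firstNorm a • (octPartLinear 2 - critRightLinear a l ∘ₗ octPartLinear 0)
      - octPairing (octPart a 0) ∘ₗ (octPartLinear 1 - critMidLinear a l ∘ₗ octPartLinear 0)).prod
        (firstPairing (octPart a 0)), fun v hv => ?_⟩
    have h3 : octPart v 0 ⬝ᵥ octPart a 0 = 0 := congrArg Prod.snd hv
    have key := P24Polar_sub_eq a v l ha hD.ne h3
    have h2' : octPairing (octPart a 0) (octPart v 1 - critMid a l (octPart v 0)) =
        firstNorm a • (octPart v 2 - critRight a l (octPart v 0)) :=
      (sub_eq_zero.1 (congrArg Prod.fst hv)).symm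
    have hJ := octPairing_dotProduct_octPairing (octPart a 0)
      (octPart v 1 - critMid a l (octPart v 0))
    have h4 := mul_nonneg (mul_nonneg (neg_pos.2 (inv_lt_zero.2 hD)).le h)
      (dotProduct_self_nonneg_real (octPart v 0))
    rw [firstNorm_sq] at hJ
    rw [h2'] at hJ key
    generalize octPart v 1 - critMid a l (octPart v 0) = p at *
    generalize octPart v 2 - critRight a l (octPart v 0) = q at *
    simp only [smul_dotProduct, dotProduct_smul, smul_eq_mul] at hJ key
    have hpq : p ⬝ᵥ p = q ⬝ᵥ q := by
      have := mul_left_cancel₀ (pow_ne_zero 2 hpos.ne')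
        ((by linarith : firstNorm a ^ 2 * (q ⬝ᵥ q) = firstNorm a ^ 2 * (p ⬝ᵥ p)))
      exact this.symm
    have hq := dotProduct_self_nonneg_real q
    rw [hpq] at key
    nlinarith

theorem exists_unit_mem_ker {E : Type*} [AddCommGroup E] [Module ℝ E] [Module.Finite ℝ E]
    (H : Submodule ℝ R24) (L : R24 →ₗ[ℝ] E) (h : Module.finrank ℝ E < Module.finrank ℝ H) :
    ∃ v ∈ H, ‖v‖ = 1 ∧ L v = 0 := by
  obtain ⟨v, hv, hv0⟩ := (Submodule.ne_bot_iff _).1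
    (LinearMap.ker_ne_bot_of_finrank_lt (f := L.domRestrict H) h)
  have hne : ‖(v : R24)‖ ≠ 0 := by simpa using hv0
  refine ⟨‖(v : R24)‖⁻¹ • (v : R24), H.smul_mem _ v.2, ?_, ?_⟩
  · rw [norm_smul, norm_inv, norm_norm, inv_mul_cancel₀ hne]
  · have : L v = 0 := hv
    rw [map_smul, this, smul_zero]

theorem inv_sqrt_three_sq : ((√3)⁻¹ : ℝ) ^ 2 = 1 / 3 := by
  rw [inv_pow, Real.sq_sqrt (by norm_num)]; norm_num

theorem inv_sqrt_three_pos : (0 : ℝ) < (√3)⁻¹ := by positivity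

/-- The function `x - x³` on `x ≥ 0` is largest at `r = 1/√3`, with value `2 r³`; the gap is `(x -
r)² (x + 2 r)`. -/
theorem abs_P24_le (a : R24) (ha : ‖a‖ = 1) : |P24 a| ≤ (√3)⁻¹ ^ 3 := by
  have h := abs_two_mul_P24_le a
  have hx := firstNorm_nonneg a
  have hr := inv_sqrt_three_sq
  have hr0 := inv_sqrt_three_pos
  rw [abs_mul, abs_two, ha] at h
  set r : ℝ := (√3)⁻¹
  set x := firstNorm a
  have : 0 ≤ (x - r) ^ 2 * (x + 2 * r) := by positivity
  have h3 : r ^ 3 = r / 3 := by rw [pow_succ, hr]; ring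
  have e : (x - r) ^ 2 * (x + 2 * r) = x ^ 3 - 3 * r ^ 2 * x + 2 * r ^ 3 := by ring
  rw [hr] at e
  linarith

theorem P24_neg (a : R24) : P24 (-a) = -P24 a := by
  rw [← neg_one_smul ℝ a, P24_smul]; ring

theorem P24Polar_neg_left (a v w : R24) : P24Polar (-a) v w = -P24Polar a v w := by
  rw [← neg_one_smul ℝ a, P24Polar_smul_left]; ring

/-- The limiting form of `exists_le_P24Polar_codim_nine`, with a bound on `l` that does not depend
on `a`. -/
theorem exists_sub_le_P24Polar_codim_nine (a : R24) (ha : ‖a‖ = 1) (l : ℝ) (hl : l ≤ (√3)⁻¹)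
    (h : 0 ≤ l ^ 3 - l + 2 * P24 a) (ε : ℝ) (hε : 0 < ε) :
    ∃ L : R24 →ₗ[ℝ] ((Fin 8 → ℝ) × ℝ), ∀ v, L v = 0 → (l - ε) * ‖v‖ ^ 2 ≤ P24Polar a v v := by
  have hm := (abs_le.1 (abs_two_mul_P24_le a)).2
  have hx := firstNorm_nonneg a
  have hr := inv_sqrt_three_sq
  have hr0 := inv_sqrt_three_pos
  rw [ha] at hm
  rcases lt_trichotomy l (firstNorm a) with hlt | heq | hgt
  · obtain ⟨L, hL⟩ := exists_le_P24Polar_codim_nine a ha l hlt h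
    exact ⟨L, fun v hv => le_trans (by nlinarith [sq_nonneg ‖v‖]) (hL v hv)⟩
  -- At `l = firstNorm a` the block is singular, so `l` is lowered slightly. The cubic then grows by
  -- `ε' (1 - 3 l² + 3 l ε' - ε'²)`, which is nonnegative for `0 ≤ l, ε' ≤ 1/√3`.
  · set ε' := min ε (√3)⁻¹ with hε'
    have h1 : 0 < ε' := lt_min hε hr0
    have h2 : ε' ≤ (√3)⁻¹ := min_le_right _ _
    have h3 : ε' ≤ ε := min_le_left _ _
    obtain ⟨L, hL⟩ := exists_le_P24Polar_codim_nine a ha (l - ε') (by linarith) (by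
      rw [← heq] at hx
      set r : ℝ := (√3)⁻¹
      have hll : l ^ 2 ≤ 1 / 3 := by rw [← hr]; exact pow_le_pow_left₀ hx hl 2
      have hee : ε' ^ 2 ≤ 1 / 3 := by rw [← hr]; exact pow_le_pow_left₀ h1.le h2 2
      have hA : 0 ≤ 1 - 3 * l ^ 2 + 3 * l * ε' - ε' ^ 2 := by
        rcases le_total ε' (3 * l) with h5 | h5
        · nlinarith
        · nlinarith
      have := mul_nonneg h1.le hA
      nlinarith)
    exact ⟨L, fun v hv => le_trans (by nlinarith [sq_nonneg ‖v‖]) (hL v hv)⟩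
  -- Since `l³ - l` strictly decreases on `[0, 1/√3]` and the cubic is nonpositive at `firstNorm a`,
  -- it would be negative at `l`.
  · exfalso
    have h1 : l ^ 2 ≤ 1 / 3 := by
      rw [← hr]; exact pow_le_pow_left₀ (hx.trans hgt.le) hl 2
    have h2 : 0 < (l - firstNorm a) * (1 - (l ^ 2 + l * firstNorm a + firstNorm a ^ 2)) := by
      apply mul_pos (by linarith)
      nlinarith
    nlinarith

/-! ### Roots of the cubic `l³ - l + 2 m` -/

/-- A root for `n` to the right of `max x r`, with `r = 1/√3`: there `l³ - l ≤ -2 m < -2 n`, while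
at `2` it equals `6 ≥ -2 n`. One level `l` then bounds one Hessian below and the other above. -/
theorem exists_cubic_root_common (x m n : ℝ) (hx : x ≤ 1) (hxm : x ^ 3 - x + 2 * m ≤ 0)
    (hm : m ≤ (√3)⁻¹ ^ 3) (hn : -1 ≤ n) (hnm : n < m) :
    ∃ l, x < l ∧ (√3)⁻¹ ≤ l ∧ 0 ≤ l ^ 3 - l + 2 * m ∧ l ^ 3 - l + 2 * n ≤ 0 := by
  have hr := inv_sqrt_three_sq
  have hr0 := inv_sqrt_three_pos
  set r : ℝ := (√3)⁻¹
  have hr3 : r ^ 3 = r / 3 := by rw [pow_succ, hr]; ring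
  have hr2 : r ≤ 1 := by nlinarith
  have hmax : (max x r) ^ 3 - max x r ≤ -2 * m := by
    rcases max_choice x r with h | h <;> rw [h] <;> linarith
  have hcont : ContinuousOn (fun l : ℝ => l ^ 3 - l) (Set.Icc (max x r) 2) := by fun_prop
  have hle : max x r ≤ 2 := max_le (by linarith) (by linarith)
  obtain ⟨l, hl, hfl⟩ := intermediate_value_Icc hle hcont
    (show -2 * n ∈ Set.Icc _ _ from ⟨by linarith, by norm_num; linarith⟩)
  dsimp only at hfl
  refine ⟨l, ?_, (le_max_right x r).trans hl.1, by linarith, by linarith⟩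
  refine lt_of_le_of_ne ((le_max_left x r).trans hl.1) ?_
  rintro rfl
  linarith

/-- `lc` is a middle root for `m`, and `lb` is then forced by the last equation: with `s = (1 - t) /
t` it is `s lc³ + 2 n`. The sign condition on `lb` becomes `lb³ ≥ s lc³`. -/
theorem exists_cubic_roots_middle (m n t : ℝ) (hm : |m| ≤ (√3)⁻¹ ^ 3) (hn : n ≤ (√3)⁻¹ ^ 3)
    (ht : 1 / 2 ≤ t) (ht1 : t ≤ 1) (hp : 0 ≤ t * n - (1 - t) * m) (hmn : m ≤ 0 ∨ m ≤ n) :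
    ∃ lb lc, lb ≤ (√3)⁻¹ ∧ -(√3)⁻¹ ≤ lc ∧ 0 ≤ lb ^ 3 - lb + 2 * n ∧ lc ^ 3 - lc + 2 * m = 0 ∧
      t * lb - (1 - t) * lc = 2 * (t * n - (1 - t) * m) := by
  have hr := inv_sqrt_three_sq
  have hr0 := inv_sqrt_three_pos
  set r : ℝ := (√3)⁻¹
  have hr3 : r ^ 3 = r / 3 := by rw [pow_succ, hr]; ring
  obtain ⟨hm1, hm2⟩ := abs_le.1 hm
  obtain ⟨s, hs⟩ : ∃ s, s = (1 - t) / t := ⟨_, rfl⟩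
  have ht0 : 0 < t := by linarith
  have hs0 : 0 ≤ s := by rw [hs]; exact div_nonneg (by linarith) ht0.le
  have hs1 : s ≤ 1 := by rw [hs, div_le_one ht0]; linarith
  have hst : t * s = 1 - t := by rw [hs]; field_simp
  have hval : ∀ lc : ℝ, lc ^ 3 - lc + 2 * m = 0 →
      t * (s * lc ^ 3 + 2 * n) - (1 - t) * lc = 2 * (t * n - (1 - t) * m) := by
    intro lc hlc
    have : lc = lc ^ 3 + 2 * m := by linarith
    have h2 : t * (s * lc ^ 3 + 2 * n) = (1 - t) * lc ^ 3 + 2 * t * n := by rw [← hst]; ring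
    rw [h2]; linear_combination (1 - t) * hlc
  have hsm : 0 ≤ n - s * m := by
    have : t * (n - s * m) = t * n - (1 - t) * m := by rw [← hst]; ring
    rw [← this] at hp
    exact nonneg_of_mul_nonneg_right hp ht0
  rcases le_or_gt m 0 with hm0 | hm0
  · have hcont : ContinuousOn (fun l : ℝ => l ^ 3 - l) (Set.Icc (-r) 0) := by fun_prop
    obtain ⟨lc, hl, hfl⟩ := intermediate_value_Icc' (neg_nonpos.2 hr0.le) hcont
      (show -2 * m ∈ Set.Icc _ _ from ⟨by norm_num; linarith, by
        rw [neg_pow, hr3]; linarith⟩)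
    dsimp only at hfl
    have hroot : lc ^ 3 - lc + 2 * m = 0 := by linarith
    have hl3 : lc ^ 3 ≤ 0 := by
      have := pow_nonneg (neg_nonneg.2 hl.2) 3
      nlinarith
    refine ⟨s * lc ^ 3 + 2 * n, lc, ?_, hl.1, ?_, hroot, hval lc hroot⟩
    · nlinarith
    -- From `n ≥ s m` follows `lb ≥ s lc³ + 2 s m = s lc`; as `lc³ ≤ 0` and `s³ ≤ s`, cubing
    -- suffices.
    · have h1 : s * lc ≤ s * lc ^ 3 + 2 * n := by nlinarith
      have h2 : (s * lc) ^ 3 ≤ (s * lc ^ 3 + 2 * n) ^ 3 :=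
        (Odd.strictMono_pow (by decide : Odd 3)).monotone h1
      have h3 : s ^ 3 ≤ s := by
        calc s ^ 3 ≤ s ^ 1 := pow_le_pow_of_le_one hs0 hs1 (by norm_num)
          _ = s := pow_one s
      have h4 : s * lc ^ 3 ≤ (s * lc) ^ 3 := by rw [mul_pow]; nlinarith
      linarith
  · have hnm : m ≤ n := hmn.resolve_left (not_le.2 hm0)
    have hcont : ContinuousOn (fun l : ℝ => l ^ 3 - l) (Set.Icc 0 r) := by fun_prop
    obtain ⟨lc, hl, hfl⟩ := intermediate_value_Icc' hr0.le hcont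
      (show -2 * m ∈ Set.Icc _ _ from ⟨by rw [hr3]; linarith, by norm_num; linarith⟩)
    dsimp only at hfl
    have hroot : lc ^ 3 - lc + 2 * m = 0 := by linarith
    have hl3 : 0 ≤ lc ^ 3 := pow_nonneg hl.1 3
    have hl3r : lc ^ 3 ≤ r ^ 3 := pow_le_pow_left₀ hl.1 hl.2 3
    have hl2 : lc ^ 2 ≤ 1 / 3 := by rw [← hr]; exact pow_le_pow_left₀ hl.1 hl.2 2
    refine ⟨s * lc ^ 3 + 2 * n, lc, ?_, by linarith [hl.1], ?_, hroot, hval lc hroot⟩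
    · nlinarith
    -- From `n ≥ m` follows `lb ≥ lc (1 - (1 - s) lc²)`, and `lc² ≤ 1/3`. The factor `(2 + s) / 3`
    -- is the arithmetic mean of `1, 1, s`, so its cube is at least `s`.
    · have h1 : lc * ((2 + s) / 3) ≤ s * lc ^ 3 + 2 * n := by
        have : lc * ((2 + s) / 3) ≤ lc * (1 - (1 - s) * lc ^ 2) :=
          mul_le_mul_of_nonneg_left (by nlinarith) hl.1
        nlinarith
      have h2 : (lc * ((2 + s) / 3)) ^ 3 ≤ (s * lc ^ 3 + 2 * n) ^ 3 :=
        pow_le_pow_left₀ (mul_nonneg hl.1 (by linarith)) h1 3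
      have h3 : s ≤ ((2 + s) / 3) ^ 3 := by nlinarith [mul_nonneg (sq_nonneg (1 - s)) (by linarith : 0 ≤ s + 8)]
      have h4 : s * lc ^ 3 ≤ (lc * ((2 + s) / 3)) ^ 3 := by rw [mul_pow]; nlinarith
      linarith

/-! ### Good directions by counting dimensions -/

/-- Pairs of orthogonality conditions as a linear map. -/
noncomputable def innerPair (b c : R24) : R24 →ₗ[ℝ] ℝ × ℝ :=
  ((innerSL ℝ b).toLinearMap).prod ((innerSL ℝ c).toLinearMap)

theorem innerPair_eq_zero {b c v : R24} (h : innerPair b c v = 0) :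
    inner ℝ b v = 0 ∧ inner ℝ c v = 0 :=
  ⟨congrArg Prod.fst h, congrArg Prod.snd h⟩

/-- Either two middle roots bound the two Hessians separately, or, when `P24 c` is positive and
exceeds `P24 b`, a common level `l` bounds one below and the other above. -/
theorem exists_P24Polar_ge_of_half_le (H : Submodule ℝ R24) (hH : Module.finrank ℝ H = 21)
    (b c : R24) (hb : ‖b‖ = 1) (hc : ‖c‖ = 1) (t : ℝ) (ht : 1 / 2 ≤ t) (ht1 : t ≤ 1)
    (hp : 0 < t * P24 b - (1 - t) * P24 c) (ε : ℝ) (hε : 0 < ε) :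
    ∃ v ∈ H, ‖v‖ = 1 ∧ inner ℝ b v = 0 ∧ inner ℝ c v = 0 ∧
      2 * (t * P24 b - (1 - t) * P24 c) - ε ≤ t * P24Polar b v v - (1 - t) * P24Polar c v v := by
  have hPb := abs_P24_le b hb
  have hPc := abs_P24_le c hc
  have hr := inv_sqrt_three_sq
  have hr0 := inv_sqrt_three_pos
  have hr3 : ((√3)⁻¹ : ℝ) ^ 3 = (√3)⁻¹ / 3 := by rw [pow_succ, hr]; ring
  by_cases hmn : P24 c ≤ 0 ∨ P24 c ≤ P24 b
  · obtain ⟨lb, lc, h1, h2, h3, h4, h5⟩ := exists_cubic_roots_middle (P24 c) (P24 b) t hPc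
      (abs_le.1 hPb).2 ht ht1 hp.le hmn
    obtain ⟨L, hL⟩ := exists_sub_le_P24Polar_codim_nine b hb lb h1 h3 ε hε
    obtain ⟨M, hM⟩ := exists_sub_le_P24Polar_codim_nine (-c) (by rwa [norm_neg]) (-lc)
      (by linarith) (by rw [P24_neg]; nlinarith) ε hε
    -- The conditions number `2 + 9 + 9 = 20 < 21`.
    obtain ⟨v, hvH, hv, hvL⟩ := exists_unit_mem_ker H ((innerPair b c).prod (L.prod M))
      (by rw [hH]; simp)
    obtain ⟨i1, i2⟩ := innerPair_eq_zero (congrArg Prod.fst hvL)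
    have hLv := hL v (congrArg (fun z => z.2.1) hvL)
    have hMv := hM v (congrArg (fun z => z.2.2) hvL)
    rw [P24Polar_neg_left] at hMv
    rw [hv] at hLv hMv
    refine ⟨v, hvH, hv, i1, i2, ?_⟩
    nlinarith
  · push Not at hmn
    have hm := (abs_le.1 (abs_two_mul_P24_le c)).2
    rw [hc] at hm
    obtain ⟨l, h1, h2, h3, h4⟩ := exists_cubic_root_common (firstNorm c) (P24 c) (P24 b)
      (hc ▸ firstNorm_le c) (by linarith) (abs_le.1 hPc).2 (by nlinarith [(abs_le.1 hPb).1]) hmn.2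
    obtain ⟨L, hL⟩ := exists_le_P24Polar_codim_seventeen b hb l h4
    -- The conditions number `2 + 17 + 1 = 20 < 21`.
    obtain ⟨v, hvH, hv, hvL⟩ := exists_unit_mem_ker H
      ((innerPair b c).prod (L.prod (firstPairing (octPart c 0)))) (by rw [hH]; simp)
    obtain ⟨i1, i2⟩ := innerPair_eq_zero (congrArg Prod.fst hvL)
    have hLv := hL v (congrArg (fun z => z.2.1) hvL)
    have hMv := P24Polar_le_of_pairing_eq_zero c hc l h1 h3 v (congrArg (fun z => z.2.2) hvL)
    rw [hv] at hLv hMv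
    refine ⟨v, hvH, hv, i1, i2, ?_⟩
    -- The direction yields `(2 t - 1) l`, while `P24 c > P24 b` and `t ≥ 1/2` bound the target by
    -- `2 (2 t - 1) l / 3`.
    have h6 : P24 b ≤ l / 3 := by linarith [(abs_le.1 hPb).2]
    nlinarith

theorem exists_P24Polar_ge (H : Submodule ℝ R24) (hH : Module.finrank ℝ H = 21)
    (b c : R24) (hb : ‖b‖ = 1) (hc : ‖c‖ = 1) (t : ℝ) (ht0 : 0 ≤ t) (ht1 : t ≤ 1)
    (hp : 0 < t * P24 b - (1 - t) * P24 c) (ε : ℝ) (hε : 0 < ε) :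
    ∃ v ∈ H, ‖v‖ = 1 ∧ inner ℝ b v = 0 ∧ inner ℝ c v = 0 ∧
      2 * (t * P24 b - (1 - t) * P24 c) - ε ≤ t * P24Polar b v v - (1 - t) * P24Polar c v v := by
  rcases le_total (1 / 2) t with ht | ht
  · exact exists_P24Polar_ge_of_half_le H hH b c hb hc t ht ht1 hp ε hε
  -- `P24` is odd, so replacing `(b, c, t)` by `(-c, -b, 1 - t)` preserves the problem.
  · obtain ⟨v, h1, h2, h3, h4, h5⟩ := exists_P24Polar_ge_of_half_le H hH (-c) (-b)
      (by rwa [norm_neg]) (by rwa [norm_neg]) (1 - t) (by linarith) (by linarith)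
      (by rw [P24_neg, P24_neg]; linarith) ε hε
    rw [inner_neg_left, neg_eq_zero] at h3 h4
    refine ⟨v, h1, h2, h4, h3, ?_⟩
    rw [P24_neg, P24_neg, P24Polar_neg_left, P24Polar_neg_left] at h5
    linarith

/-- By linearity the combination is the Hessian at `d = t b - (1 - t) c`. At the unit vector `d /
|d|` the cubic is nonpositive at `l = 1/√3`, whatever the value of `P24`; the conditions number `2 +
17 = 19`. -/
theorem exists_P24Polar_combination_ge (H : Submodule ℝ R24) (hH : Module.finrank ℝ H = 21)
    (b c : R24) (t : ℝ) :
    ∃ v ∈ H, ‖v‖ = 1 ∧ inner ℝ b v = 0 ∧ inner ℝ c v = 0 ∧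
      (√3)⁻¹ * ‖t • b - (1 - t) • c‖ ≤ t * P24Polar b v v - (1 - t) * P24Polar c v v := by
  have hlin : ∀ v, P24Polar (t • b - (1 - t) • c) v v =
      t * P24Polar b v v - (1 - t) * P24Polar c v v := by
    intro v
    rw [sub_eq_add_neg, P24Polar_add_left, P24Polar_neg_left, P24Polar_smul_left,
      P24Polar_smul_left]
    ring
  simp only [← hlin]
  generalize t • b - (1 - t) • c = d
  rcases eq_or_ne d 0 with rfl | hd
  · obtain ⟨v, hvH, hv, hvL⟩ := exists_unit_mem_ker H (innerPair b c) (by rw [hH]; simp)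
    obtain ⟨i1, i2⟩ := innerPair_eq_zero hvL
    refine ⟨v, hvH, hv, i1, i2, ?_⟩
    have := P24Polar_smul_left 0 (0 : R24) v v
    rw [zero_smul, zero_mul] at this
    rw [this, norm_zero, mul_zero]
  · have hd' : ‖d‖ ≠ 0 := norm_ne_zero_iff.2 hd
    have hu : ‖‖d‖⁻¹ • d‖ = 1 := by rw [norm_smul, norm_inv, norm_norm, inv_mul_cancel₀ hd']
    have hr := inv_sqrt_three_sq
    have hr3 : ((√3)⁻¹ : ℝ) ^ 3 = (√3)⁻¹ / 3 := by rw [pow_succ, hr]; ring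
    obtain ⟨L, hL⟩ := exists_le_P24Polar_codim_seventeen (‖d‖⁻¹ • d) hu (√3)⁻¹
      (by linarith [(abs_le.1 (abs_P24_le _ hu)).2])
    obtain ⟨v, hvH, hv, hvL⟩ := exists_unit_mem_ker H ((innerPair b c).prod L)
      (by rw [hH]; simp)
    obtain ⟨i1, i2⟩ := innerPair_eq_zero (congrArg Prod.fst hvL)
    have hLv := hL v (congrArg Prod.snd hvL)
    refine ⟨v, hvH, hv, i1, i2, ?_⟩
    rw [hv, P24Polar_smul_left, one_pow, mul_one, inv_mul_eq_div,
      le_div_iff₀ (norm_pos_iff.2 hd)] at hLv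
    exact hLv

/-! ### The Hessian of the homogeneous function -/

/-- The positive multiple `‖x‖ ^ (δ + 4) * D²(w24 δ)(x)` of the Hessian of `w24 δ` as a bilinear
form; it is polynomial in `x`. -/
noncomputable def w24Form (δ : ℝ) (x v w : R24) : ℝ :=
  inner ℝ x x ^ 2 * P24Polar x v w
    - δ / 2 * inner ℝ x x * (P24Polar x x v * inner ℝ x w + P24Polar x x w * inner ℝ x v)
    - δ * inner ℝ x x * P24 x * inner ℝ v w
    + δ * (δ + 2) * P24 x * inner ℝ x v * inner ℝ x w

theorem w24Form_of_orthogonal (δ : ℝ) (x v : R24) (hx : ‖x‖ = 1) (hv : ‖v‖ = 1)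
    (hxv : inner ℝ x v = 0) : w24Form δ x v v = P24Polar x v v - δ * P24 x := by
  simp [w24Form, hxv, hx, hv]

/-- The uniform one-sided bound for the differences of Hessians of `w24 δ` on a subspace of
codimension three. -/
theorem exists_w24Form_combination_ge (δ : ℝ) (hδ₀ : 0 ≤ δ) (hδ₂ : δ < 2)
    (H : Submodule ℝ R24) (hH : Module.finrank ℝ H = 21)
    (b c : R24) (hb : ‖b‖ = 1) (hc : ‖c‖ = 1) (t : ℝ) (ht0 : 0 ≤ t) (ht1 : t ≤ 1) :
    ∃ v ∈ H, ‖v‖ = 1 ∧ (2 - δ) * (√3)⁻¹ / 4 * ‖t • b - (1 - t) • c‖ ≤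
      t * w24Form δ b v v - (1 - t) * w24Form δ c v v := by
  have hr0 := inv_sqrt_three_pos
  set D := ‖t • b - (1 - t) • c‖ with hD
  have hD0 : 0 ≤ D := norm_nonneg _
  obtain ⟨v, h1, h2, h3, h4, h5⟩ := exists_P24Polar_combination_ge H hH b c t
  rw [← hD] at h5
  have hval : ∀ v : R24, ‖v‖ = 1 → inner ℝ b v = 0 → inner ℝ c v = 0 →
      t * w24Form δ b v v - (1 - t) * w24Form δ c v v =
        t * P24Polar b v v - (1 - t) * P24Polar c v v
          - δ * (t * P24 b - (1 - t) * P24 c) := by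
    intro v hv h3 h4
    rw [w24Form_of_orthogonal δ b v hb hv h3, w24Form_of_orthogonal δ c v hc hv h4]; ring
  set r : ℝ := (√3)⁻¹
  have hpos : 0 ≤ (2 - δ) * (r * D) := mul_nonneg (by linarith) (mul_nonneg hr0.le hD0)
  -- At the threshold `r D / 2` the bound `r D - δ p` and the bound `(2 - δ) p` both give `(2 - δ) r
  -- D / 2`; half of this is kept to absorb `ε`.
  rcases le_or_gt (t * P24 b - (1 - t) * P24 c) (r * D / 2) with hp | hp
  · refine ⟨v, h1, h2, ?_⟩
    rw [hval v h2 h3 h4]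
    nlinarith
  · rcases hD0.eq_or_lt with h0 | h0
    · exfalso
      have hd : t • b = (1 - t) • c := sub_eq_zero.1 (norm_eq_zero.1 h0.symm)
      have hn := congrArg norm hd
      rw [norm_smul, norm_smul, hb, hc, Real.norm_of_nonneg ht0,
        Real.norm_of_nonneg (by linarith : 0 ≤ 1 - t)] at hn
      have ht : t = 1 / 2 := by linarith
      subst ht
      have hbc : b = c := by
        have h6 : ((1 : ℝ) - 1 / 2) = 1 / 2 := by norm_num
        rw [h6] at hd
        exact smul_right_injective R24 (by norm_num : (1 / 2 : ℝ) ≠ 0) hd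
      rw [hbc, ← h0] at hp
      linarith
    · have hrD : 0 < r * D := mul_pos hr0 h0
      have hε : 0 < (2 - δ) * (r * D) / 4 := by
        have := mul_pos (by linarith : 0 < 2 - δ) hrD
        linarith
      obtain ⟨v, h1, h2, h3, h4, h5⟩ := exists_P24Polar_ge H hH b c hb hc t ht0 ht1
        (by linarith) _ hε
      refine ⟨v, h1, h2, ?_⟩
      rw [hval v h2 h3 h4]
      have := mul_le_mul_of_nonneg_left hp.le (by linarith : 0 ≤ 2 - δ)
      linarith

/-! ### Elliptic matrices and the trace pairing -/

/-- The trace pairing `∑ᵢⱼ Aᵢⱼ Mᵢⱼ`. -/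
def matrixPairing {n : ℕ} (A M : Matrix (Fin n) (Fin n) ℝ) : ℝ := ∑ i, ∑ j, A i j * M i j

theorem matrixPairing_add_left {n : ℕ} (A B M : Matrix (Fin n) (Fin n) ℝ) :
    matrixPairing (A + B) M = matrixPairing A M + matrixPairing B M := by
  simp [matrixPairing, add_mul, Finset.sum_add_distrib]

theorem matrixPairing_smul_left {n : ℕ} (c : ℝ) (A M : Matrix (Fin n) (Fin n) ℝ) :
    matrixPairing (c • A) M = c * matrixPairing A M := by
  simp [matrixPairing, Finset.mul_sum, mul_assoc]

theorem matrixPairing_sub_right {n : ℕ} (A M N : Matrix (Fin n) (Fin n) ℝ) :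
    matrixPairing A (M - N) = matrixPairing A M - matrixPairing A N := by
  simp [matrixPairing, mul_sub, Finset.sum_sub_distrib]

theorem matrixPairing_smul_right {n : ℕ} (c : ℝ) (A M : Matrix (Fin n) (Fin n) ℝ) :
    matrixPairing A (c • M) = c * matrixPairing A M := by
  simp [matrixPairing, Finset.mul_sum, mul_left_comm]

theorem dotProduct_mulVec_eq_sum {n : ℕ} (A : Matrix (Fin n) (Fin n) ℝ) (ξ : Fin n → ℝ) :
    ξ ⬝ᵥ A.mulVec ξ = ∑ i, ∑ j, A i j * ξ i * ξ j := by
  simp only [dotProduct, Matrix.mulVec, Finset.mul_sum]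
  exact Finset.sum_congr rfl fun i _ => Finset.sum_congr rfl fun j _ => by ring

theorem IsEllipticMatrix.posSemidef {n : ℕ} {C : ℝ} {A : Matrix (Fin n) (Fin n) ℝ} (hC : 0 < C)
    (hA : IsEllipticMatrix C A) : A.PosSemidef := by
  refine .of_dotProduct_mulVec_nonneg ?_ fun x => ?_
  · rw [Matrix.IsHermitian, Matrix.conjTranspose_eq_transpose_of_trivial]; exact hA.1
  · rw [star_trivial, dotProduct_mulVec_eq_sum]
    exact (mul_nonneg (inv_pos.2 hC).le (Finset.sum_nonneg fun i _ => sq_nonneg _)).trans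
      (hA.2 x).1

-- Writing `A = Bᵀ B` turns the pairing into the sum of the quadratic form of `M` over the rows of
-- `B`.
open scoped MatrixOrder in
theorem matrixPairing_nonneg {n : ℕ} {A M : Matrix (Fin n) (Fin n) ℝ} (hA : A.PosSemidef)
    (hM : ∀ ξ : Fin n → ℝ, 0 ≤ ∑ i, ∑ j, M i j * ξ i * ξ j) : 0 ≤ matrixPairing A M := by
  obtain ⟨B, rfl⟩ := CStarAlgebra.nonneg_iff_eq_star_mul_self.1 hA.nonneg
  have : matrixPairing (star B * B) M = ∑ k, ∑ i, ∑ j, M i j * B k i * B k j := by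
    simp only [matrixPairing, Matrix.star_eq_conjTranspose,
      Matrix.conjTranspose_eq_transpose_of_trivial, Matrix.mul_apply, Matrix.transpose_apply,
      Finset.sum_mul]
    rw [Finset.sum_comm' (t' := Finset.univ) (s' := fun _ => Finset.univ) (by simp)]
    rw [Finset.sum_comm]
    conv_rhs => rw [Finset.sum_comm]
    refine Finset.sum_congr rfl fun i _ => ?_
    conv_rhs => rw [Finset.sum_comm]
    exact Finset.sum_congr rfl fun j _ => Finset.sum_congr rfl fun k _ => by ring
  rw [this]
  exact Finset.sum_nonneg fun k _ => hM (B k)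

theorem IsEllipticMatrix.abs_apply_le {n : ℕ} {C : ℝ} {A : Matrix (Fin n) (Fin n) ℝ} (hC : 0 < C)
    (hA : IsEllipticMatrix C A) (i j : Fin n) : |A i j| ≤ C := by
  have hsymm : A j i = A i j := hA.1.apply i j
  have hq : ∀ ξ : Fin n → ℝ, 0 ≤ ξ ⬝ᵥ A.mulVec ξ ∧ ξ ⬝ᵥ A.mulVec ξ ≤ C * (ξ ⬝ᵥ ξ) := by
    intro ξ
    rw [dotProduct_mulVec_eq_sum]
    have h1 : ξ ⬝ᵥ ξ = ∑ i, ξ i ^ 2 := by simp [dotProduct, sq]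
    rw [h1]
    exact ⟨(mul_nonneg (inv_pos.2 hC).le (Finset.sum_nonneg fun i _ => sq_nonneg _)).trans
      (hA.2 ξ).1, (hA.2 ξ).2⟩
  set u : Fin n → ℝ := Pi.single i 1 with hu
  set w : Fin n → ℝ := Pi.single j 1 with hw
  have e1 : u ⬝ᵥ A.mulVec w = A i j := by simp [hu, hw]
  have e2 : w ⬝ᵥ A.mulVec u = A i j := by simp [hu, hw, hsymm]
  have e3 : u ⬝ᵥ u = 1 := by simp [hu]
  have e4 : w ⬝ᵥ w = 1 := by simp [hw]
  have hp := hq (u + w)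
  have hm := hq (u - w)
  simp only [Matrix.mulVec_add, Matrix.mulVec_sub, dotProduct_add, dotProduct_sub, add_dotProduct,
    sub_dotProduct, e1, e2, e3, e4, dotProduct_comm w u] at hp hm
  have huw : |u ⬝ᵥ w| ≤ 1 := by
    rw [hu, hw]
    simp only [single_dotProduct, one_mul, Pi.single_apply]
    split_ifs <;> simp
  have := abs_le.1 huw
  rw [abs_le]
  have hu1 := hq u
  have hw1 := hq w
  rw [e3] at hu1
  rw [e4] at hw1
  constructor <;> nlinarith

theorem IsEllipticMatrix.abs_matrixPairing_le {n : ℕ} {C : ℝ} {A : Matrix (Fin n) (Fin n) ℝ}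
    (hC : 0 < C) (hA : IsEllipticMatrix C A) (M : Matrix (Fin n) (Fin n) ℝ) :
    |matrixPairing A M| ≤ C * ∑ i, ∑ j, |M i j| := by
  rw [Finset.mul_sum]
  refine (Finset.abs_sum_le_sum_abs _ _).trans (Finset.sum_le_sum fun i _ => ?_)
  rw [Finset.mul_sum]
  refine (Finset.abs_sum_le_sum_abs _ _).trans (Finset.sum_le_sum fun j _ => ?_)
  rw [abs_mul]
  exact mul_le_mul_of_nonneg_right (hA.abs_apply_le hC i j) (abs_nonneg _)

theorem convex_isEllipticMatrix {n : ℕ} (C : ℝ) :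
    Convex ℝ {A : Matrix (Fin n) (Fin n) ℝ | IsEllipticMatrix C A} := by
  intro A hA B hB s t hs ht hst
  refine ⟨?_, fun ξ => ?_⟩
  · exact (hA.1.smul s).add (hB.1.smul t)
  · have e : ∑ i, ∑ j, (s • A + t • B) i j * ξ i * ξ j =
        s * ∑ i, ∑ j, A i j * ξ i * ξ j + t * ∑ i, ∑ j, B i j * ξ i * ξ j := by
      simp only [Matrix.add_apply, Matrix.smul_apply, smul_eq_mul, add_mul,
        Finset.sum_add_distrib, Finset.mul_sum, mul_assoc]
    rw [e]
    obtain ⟨a1, a2⟩ := hA.2 ξ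
    obtain ⟨b1, b2⟩ := hB.2 ξ
    have hs' : s = 1 - t := by linarith
    constructor
    · calc _ = s * (C⁻¹ * ∑ i, ξ i ^ 2) + t * (C⁻¹ * ∑ i, ξ i ^ 2) := by rw [hs']; ring
        _ ≤ _ := add_le_add (mul_le_mul_of_nonneg_left a1 hs) (mul_le_mul_of_nonneg_left b1 ht)
    · calc _ ≤ s * (C * ∑ i, ξ i ^ 2) + t * (C * ∑ i, ξ i ^ 2) :=
          add_le_add (mul_le_mul_of_nonneg_left a2 hs) (mul_le_mul_of_nonneg_left b2 ht)
        _ = _ := by rw [hs']; ring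

theorem isCompact_isEllipticMatrix {n : ℕ} {C : ℝ} (hC : 0 < C) :
    IsCompact {A : Matrix (Fin n) (Fin n) ℝ | IsEllipticMatrix C A} := by
  have hbox : IsCompact (Set.univ.pi fun _ : Fin n => Set.univ.pi fun _ : Fin n =>
      Set.Icc (-C) C) := isCompact_univ_pi fun _ => isCompact_univ_pi fun _ => isCompact_Icc
  refine IsCompact.of_isClosed_subset (X := Fin n → Fin n → ℝ) hbox ?_ ?_
  · have h1 : IsClosed {A : Matrix (Fin n) (Fin n) ℝ | A.IsSymm} :=
      isClosed_eq (by fun_prop) continuous_id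
    have h2 : IsClosed {A : Matrix (Fin n) (Fin n) ℝ | ∀ ξ : Fin n → ℝ,
        C⁻¹ * ∑ i, ξ i ^ 2 ≤ ∑ i, ∑ j, A i j * ξ i * ξ j ∧
          ∑ i, ∑ j, A i j * ξ i * ξ j ≤ C * ∑ i, ξ i ^ 2} := by
      simp only [Set.ofPred_forall]
      refine isClosed_iInter fun ξ => ?_
      have hc : Continuous fun A : Matrix (Fin n) (Fin n) ℝ => ∑ i, ∑ j, A i j * ξ i * ξ j := by
        fun_prop
      exact (isClosed_le continuous_const hc).inter (isClosed_le hc continuous_const)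
    exact h1.inter h2
  · intro A hA i _ j _
    exact abs_le.1 (IsEllipticMatrix.abs_apply_le hC hA i j)

/-- The matrix `1 + k v vᵀ` is elliptic for a unit vector `v` and `0 ≤ k`. -/
theorem isEllipticMatrix_one_add_smul_vecMulVec {n : ℕ} (k : ℝ) (hk : 0 ≤ k) (v : Fin n → ℝ)
    (hv : ∑ i, v i ^ 2 = 1) : IsEllipticMatrix (1 + k) (1 + k • Matrix.vecMulVec v v) := by
  refine ⟨Matrix.isSymm_one.add (Matrix.IsSymm.smul ?_ k), fun ξ => ?_⟩
  · exact Matrix.transpose_vecMulVec v v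
  · have e : ∑ i, ∑ j, (1 + k • Matrix.vecMulVec v v : Matrix (Fin n) (Fin n) ℝ) i j * ξ i * ξ j =
        ∑ i, ξ i ^ 2 + k * (∑ i, v i * ξ i) ^ 2 := by
      rw [← dotProduct_mulVec_eq_sum, Matrix.add_mulVec, Matrix.one_mulVec, dotProduct_add,
        Matrix.smul_mulVec, dotProduct_smul, dotProduct_mulVec_eq_sum, smul_eq_mul, sq (∑ i, _),
        Finset.sum_mul_sum]
      congr 1
      · simp [dotProduct, sq]
      · congr 1
        exact Finset.sum_congr rfl fun i _ => Finset.sum_congr rfl fun j _ => by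
          rw [Matrix.vecMulVec_apply]; ring
    have hcs := Finset.sum_mul_sq_le_sq_mul_sq Finset.univ v ξ
    rw [hv, one_mul] at hcs
    have hn : 0 ≤ ∑ i, ξ i ^ 2 := Finset.sum_nonneg fun i _ => sq_nonneg _
    rw [e]
    constructor
    · have : (1 + k)⁻¹ ≤ 1 := inv_le_one_of_one_le₀ (by linarith)
      have h2 : 0 ≤ k * (∑ i, v i * ξ i) ^ 2 := by positivity
      nlinarith
    · nlinarith

theorem matrixPairing_one_add_smul_vecMulVec {n : ℕ} (k : ℝ) (v : Fin n → ℝ)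
    (M : Matrix (Fin n) (Fin n) ℝ) :
    matrixPairing (1 + k • Matrix.vecMulVec v v) M =
      M.trace + k * ∑ i, ∑ j, M i j * v i * v j := by
  rw [matrixPairing_add_left, matrixPairing_smul_left]
  congr 1
  · simp [matrixPairing, Matrix.one_apply, Matrix.trace]
  · congr 1
    exact Finset.sum_congr rfl fun i _ => Finset.sum_congr rfl fun j _ => by
      rw [Matrix.vecMulVec_apply]; ring

/-! ### A planar minimax principle -/

/-- If `K` misses the closed quadrant, a functional separates them strictly. Being bounded below on
the quadrant it has nonnegative coefficients, and normalizing their sum to `1` produces a `t` that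
contradicts the hypothesis. -/
theorem Convex.exists_mem_quadrant {K : Set (ℝ × ℝ)} (hK : Convex ℝ K) (hKc : IsCompact K)
    (h : ∀ t : ℝ, 0 ≤ t → t ≤ 1 → ∃ k ∈ K, 0 ≤ t * k.1 + (1 - t) * k.2) :
    ∃ k ∈ K, 0 ≤ k.1 ∧ 0 ≤ k.2 := by
  by_contra! hcon
  have hdisj : Disjoint K (Set.Ici (0 : ℝ × ℝ)) := by
    rw [Set.disjoint_left]
    intro k hk hk'
    exact absurd hk'.2 (not_le.2 (hcon k hk hk'.1))
  obtain ⟨f, u, v, h1, h2, h3⟩ := geometric_hahn_banach_compact_closed hK hKc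
    (convex_Ici (0 : ℝ × ℝ)) isClosed_Ici hdisj
  have hf : ∀ x y : ℝ, f (x, y) = x * f (1, 0) + y * f (0, 1) := by
    intro x y
    have : ((x, y) : ℝ × ℝ) = x • (1, 0) + y • (0, 1) := by simp
    rw [this, map_add, map_smul, map_smul, smul_eq_mul, smul_eq_mul]
  have hv0 : v < 0 := by simpa using h3 0 (Set.mem_Ici.2 le_rfl)
  have hnonneg : ∀ α : ℝ, (∀ s : ℝ, 0 ≤ s → v < s * α) → 0 ≤ α := by
    intro α hα
    by_contra! hneg
    have := hα (v / α) (div_nonneg_of_nonpos hv0.le hneg.le)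
    rw [div_mul_cancel₀ _ hneg.ne] at this
    exact lt_irrefl _ this
  have ha : 0 ≤ f (1, 0) := hnonneg _ fun s hs => by
    have := h3 (s, 0) ⟨hs, le_rfl⟩
    rwa [hf, zero_mul, add_zero] at this
  have hb : 0 ≤ f (0, 1) := hnonneg _ fun s hs => by
    have := h3 (0, s) ⟨le_rfl, hs⟩
    rwa [hf, zero_mul, zero_add] at this
  rcases (add_nonneg ha hb).eq_or_lt with h0 | h0
  · obtain ⟨k, hk, -⟩ := h 0 le_rfl zero_le_one
    have := h1 k hk
    have hfa : f (1, 0) = 0 := by linarith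
    have hfb : f (0, 1) = 0 := by linarith
    rw [← Prod.mk.eta (p := k), hf, hfa, hfb] at this
    linarith
  · obtain ⟨k, hk, hkt⟩ := h (f (1, 0) / (f (1, 0) + f (0, 1))) (div_nonneg ha h0.le)
      ((div_le_one h0).2 (by linarith))
    have hlt := h1 k hk
    rw [← Prod.mk.eta (p := k), hf] at hlt
    have e : (f (1, 0) + f (0, 1)) * (f (1, 0) / (f (1, 0) + f (0, 1)) * k.1 +
        (1 - f (1, 0) / (f (1, 0) + f (0, 1))) * k.2) = k.1 * f (1, 0) + k.2 * f (0, 1) := by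
      field_simp; ring
    have := mul_nonneg h0.le hkt
    rw [e] at this
    linarith

/-- A minimax principle: if each combination of `M` and `-N` is nonnegative against some elliptic
matrix, then one elliptic matrix separates `M` from `N`. -/
theorem exists_isEllipticMatrix_separating {n : ℕ} {C : ℝ} (hC : 0 < C)
    (M N : Matrix (Fin n) (Fin n) ℝ)
    (h : ∀ t : ℝ, 0 ≤ t → t ≤ 1 → ∃ A, IsEllipticMatrix C A ∧
      0 ≤ matrixPairing A (t • M - (1 - t) • N)) :
    ∃ A, IsEllipticMatrix C A ∧ 0 ≤ matrixPairing A M ∧ matrixPairing A N ≤ 0 := by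
  let Λ : Matrix (Fin n) (Fin n) ℝ →ₗ[ℝ] ℝ × ℝ :=
    { toFun := fun A => (matrixPairing A M, -matrixPairing A N)
      map_add' := fun A B => by
        simp only [matrixPairing_add_left, neg_add, Prod.mk_add_mk]
      map_smul' := fun c A => by
        simp only [matrixPairing_smul_left, RingHom.id_apply, Prod.smul_mk, smul_eq_mul, mul_neg] }
  have hΛ : Continuous Λ := by
    have h1 : ∀ M : Matrix (Fin n) (Fin n) ℝ, Continuous fun A => matrixPairing A M := by
      intro M; unfold matrixPairing; fun_prop
    exact (h1 M).prodMk (h1 N).neg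
  obtain ⟨_, ⟨A, hA, rfl⟩, h1, h2⟩ := Convex.exists_mem_quadrant
    ((convex_isEllipticMatrix C).linear_image Λ) ((isCompact_isEllipticMatrix hC).image hΛ)
    (fun t ht0 ht1 => by
      obtain ⟨A, hA, hAt⟩ := h t ht0 ht1
      refine ⟨Λ A, ⟨A, hA, rfl⟩, ?_⟩
      rw [matrixPairing_sub_right, matrixPairing_smul_right, matrixPairing_smul_right] at hAt
      change 0 ≤ t * matrixPairing A M + (1 - t) * -matrixPairing A N
      linarith)
  exact ⟨A, hA, h1, neg_nonneg.1 h2⟩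

/-! ### The Hessian forms as matrices -/

theorem w24Form_add_mid (δ : ℝ) (x v v' w : R24) :
    w24Form δ x (v + v') w = w24Form δ x v w + w24Form δ x v' w := by
  simp only [w24Form, P24Polar_add_mid, P24Polar_add_right, inner_add_left, inner_add_right]
  ring

theorem w24Form_smul_mid (δ : ℝ) (c : ℝ) (x v w : R24) :
    w24Form δ x (c • v) w = c * w24Form δ x v w := by
  simp only [w24Form, P24Polar_smul_mid, P24Polar_smul_right, real_inner_smul_left,
    real_inner_smul_right]
  ring

theorem w24Form_comm (δ : ℝ) (x v w : R24) : w24Form δ x v w = w24Form δ x w v := by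
  simp only [w24Form, P24Polar_swap_right x v w, real_inner_comm w v]
  ring

theorem w24Form_smul_left (δ : ℝ) (c : ℝ) (x v w : R24) :
    w24Form δ (c • x) v w = c ^ 5 * w24Form δ x v w := by
  simp only [w24Form, P24Polar_smul_left, P24Polar_smul_mid, real_inner_smul_left,
    real_inner_smul_right, P24_smul]
  ring

/-- `w24Form δ x` as a bilinear map. -/
noncomputable def w24Bilin (δ : ℝ) (x : R24) : R24 →ₗ[ℝ] R24 →ₗ[ℝ] ℝ :=
  LinearMap.mk₂ ℝ (w24Form δ x) (w24Form_add_mid δ x) (fun c v w => w24Form_smul_mid δ c x v w)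
    (fun v w w' => by
      rw [w24Form_comm, w24Form_add_mid, w24Form_comm δ x w, w24Form_comm δ x w'])
    (fun c v w => by rw [w24Form_comm, w24Form_smul_mid, w24Form_comm δ x w, smul_eq_mul])

theorem sum_bilinear_single {n : ℕ}
    (B : EuclideanSpace ℝ (Fin n) →ₗ[ℝ] EuclideanSpace ℝ (Fin n) →ₗ[ℝ] ℝ)
    (ξ : EuclideanSpace ℝ (Fin n)) :
    ∑ i, ∑ j, B (EuclideanSpace.single i 1) (EuclideanSpace.single j 1) * ξ i * ξ j = B ξ ξ := by
  have hξ : ξ = ∑ i, ξ i • EuclideanSpace.single i (1 : ℝ) := by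
    ext j; simp [Pi.single_apply]
  conv_rhs => rw [hξ]
  simp only [map_sum, map_smul, LinearMap.sum_apply, LinearMap.smul_apply, smul_eq_mul,
    Finset.mul_sum]
  rw [Finset.sum_comm]
  exact Finset.sum_congr rfl fun i _ => Finset.sum_congr rfl fun j _ => by ring

/-- The matrix of `w24Form δ x` in the coordinates given by `J`. -/
noncomputable def w24Matrix {n : ℕ} (δ : ℝ) (J : EuclideanSpace ℝ (Fin n) →ₗ[ℝ] R24) (x : R24) :
    Matrix (Fin n) (Fin n) ℝ :=
  Matrix.of fun i j => w24Form δ x (J (EuclideanSpace.single i 1)) (J (EuclideanSpace.single j 1))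

theorem sum_w24Matrix {n : ℕ} (δ : ℝ) (J : EuclideanSpace ℝ (Fin n) →ₗ[ℝ] R24) (x : R24)
    (ξ : EuclideanSpace ℝ (Fin n)) :
    ∑ i, ∑ j, w24Matrix δ J x i j * ξ i * ξ j = w24Form δ x (J ξ) (J ξ) :=
  sum_bilinear_single ((w24Bilin δ x).compl₁₂ J J) ξ

theorem w24Matrix_smul {n : ℕ} (δ : ℝ) (J : EuclideanSpace ℝ (Fin n) →ₗ[ℝ] R24) (c : ℝ)
    (x : R24) : w24Matrix δ J (c • x) = c ^ 5 • w24Matrix δ J x := by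
  ext i j
  simp [w24Matrix, w24Form_smul_left]

/-! ### Smoothness in the base point -/

theorem contDiff_octMul {E : Type*} [NormedAddCommGroup E] [NormedSpace ℝ E]
    {f g : E → Fin 8 → ℝ} (hf : ∀ i, ContDiff ℝ 1 fun x => f x i)
    (hg : ∀ i, ContDiff ℝ 1 fun x => g x i) (i : Fin 8) :
    ContDiff ℝ 1 fun x => octMul (f x) (g x) i := by
  fin_cases i <;> simp only [octMul, Fin.zero_eta, Fin.mk_one, Fin.reduceFinMk] <;>
    simp <;> fun_prop

theorem contDiff_octTriple {E : Type*} [NormedAddCommGroup E] [NormedSpace ℝ E]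
    {f g h : E → Fin 8 → ℝ} (hf : ∀ i, ContDiff ℝ 1 fun x => f x i)
    (hg : ∀ i, ContDiff ℝ 1 fun x => g x i) (hh : ∀ i, ContDiff ℝ 1 fun x => h x i) :
    ContDiff ℝ 1 fun x => octTriple (f x) (g x) (h x) :=
  contDiff_octMul (contDiff_octMul hf hg) hh 0

theorem contDiff_octPart (j : Fin 3) (i : Fin 8) : ContDiff ℝ 1 fun x : R24 => octPart x j i := by
  unfold octPart; fun_prop

theorem contDiff_P24Polar {f g h : R24 → R24} (hf : ContDiff ℝ 1 f) (hg : ContDiff ℝ 1 g)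
    (hh : ContDiff ℝ 1 h) : ContDiff ℝ 1 fun x => P24Polar (f x) (g x) (h x) := by
  have hF := fun j i => (contDiff_octPart j i).comp hf
  have hG := fun j i => (contDiff_octPart j i).comp hg
  have hH := fun j i => (contDiff_octPart j i).comp hh
  unfold P24Polar
  refine ((((ContDiff.add ?_ ?_).add ?_).add ?_).add ?_).add ?_ <;>
    apply contDiff_octTriple <;> first | exact hF _ | exact hG _ | exact hH _

theorem contDiff_P24 : ContDiff ℝ 1 P24 :=
  contDiff_octTriple (contDiff_octPart 0) (contDiff_octPart 1) (contDiff_octPart 2)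

theorem contDiff_w24Form (δ : ℝ) (v w : R24) : ContDiff ℝ 1 fun x => w24Form δ x v w := by
  have h1 : ContDiff ℝ 1 fun x => P24Polar x v w :=
    contDiff_P24Polar contDiff_id contDiff_const contDiff_const
  have h2 : ∀ v, ContDiff ℝ 1 fun x => P24Polar x x v := fun v =>
    contDiff_P24Polar contDiff_id contDiff_id contDiff_const
  have h3 := contDiff_P24
  have h4 := h2 v
  have h5 := h2 w
  have i1 : ∀ v : R24, ContDiff ℝ 1 fun x => (inner ℝ x v : ℝ) := fun v =>
    contDiff_id.inner ℝ contDiff_const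
  have i2 : ContDiff ℝ 1 fun x : R24 => (inner ℝ x x : ℝ) := contDiff_id.inner ℝ contDiff_id
  have i3 := i1 v
  have i4 := i1 w
  exact ((((i2.pow 2).mul h1).sub ((contDiff_const.mul i2).mul ((h4.mul i4).add (h5.mul i3)))).sub
    (((contDiff_const.mul i2).mul h3).mul contDiff_const)).add
    (((contDiff_const.mul h3).mul i3).mul i4)

theorem exists_lipschitz_on_sphere {f : R24 → ℝ} (hf : ContDiff ℝ 1 f) :
    ∃ K, 0 ≤ K ∧ (∀ b c : R24, ‖b‖ = 1 → ‖c‖ = 1 → |f b - f c| ≤ K * ‖b - c‖) ∧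
      ∀ c : R24, ‖c‖ = 1 → |f c| ≤ K := by
  have hcomp := isCompact_closedBall (0 : R24) 1
  obtain ⟨K₁, hK₁⟩ := hcomp.exists_bound_of_continuousOn
    (hf.continuous_fderiv (by norm_num)).continuousOn
  obtain ⟨K₂, hK₂⟩ := hcomp.exists_bound_of_continuousOn hf.continuous.continuousOn
  have hmem : ∀ b : R24, ‖b‖ = 1 → b ∈ Metric.closedBall (0 : R24) 1 := fun b hb => by
    rw [mem_closedBall_zero_iff, hb]
  refine ⟨max 0 (max K₁ K₂), le_max_left _ _, fun b c hb hc => ?_, fun c hc => ?_⟩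
  · have := (convex_closedBall (0 : R24) 1).norm_image_sub_le_of_norm_fderiv_le
      (fun x _ => (hf.differentiable (by norm_num)) x) hK₁ (hmem c hc) (hmem b hb)
    rw [Real.norm_eq_abs] at this
    refine this.trans (mul_le_mul_of_nonneg_right ?_ (norm_nonneg _))
    exact (le_max_left _ _).trans (le_max_right _ _)
  · exact (hK₂ c (hmem c hc)).trans ((le_max_right _ _).trans (le_max_right _ _))

/-- On the sphere, smallness of `t b - (1 - t) c` forces both `|2 t - 1|` and `t |b - c|` to be
small, so no linearity of `f` is needed. -/
theorem abs_combination_le_of_lipschitz {f : R24 → ℝ} {K : ℝ} (hK : 0 ≤ K)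
    (hlip : ∀ b c : R24, ‖b‖ = 1 → ‖c‖ = 1 → |f b - f c| ≤ K * ‖b - c‖)
    (hbd : ∀ c : R24, ‖c‖ = 1 → |f c| ≤ K) {b c : R24} (hb : ‖b‖ = 1) (hc : ‖c‖ = 1) {t : ℝ}
    (ht0 : 0 ≤ t) (ht1 : t ≤ 1) :
    |t * f b - (1 - t) * f c| ≤ 3 * K * ‖t • b - (1 - t) • c‖ := by
  set D := ‖t • b - (1 - t) • c‖ with hD
  have h1 : |2 * t - 1| ≤ D := by
    have := abs_norm_sub_norm_le (t • b) ((1 - t) • c)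
    rw [norm_smul, norm_smul, hb, hc, Real.norm_of_nonneg ht0,
      Real.norm_of_nonneg (by linarith : 0 ≤ 1 - t)] at this
    calc |2 * t - 1| = |t * 1 - (1 - t) * 1| := by congr 1; ring
      _ ≤ D := this
  have h2 : t * ‖b - c‖ ≤ 2 * D := by
    have e : t • (b - c) = (t • b - (1 - t) • c) - (2 * t - 1) • c := by module
    calc t * ‖b - c‖ = ‖t • (b - c)‖ := by rw [norm_smul, Real.norm_of_nonneg ht0]
      _ ≤ D + ‖(2 * t - 1) • c‖ := by rw [e]; exact norm_sub_le _ _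
      _ ≤ 2 * D := by rw [norm_smul, hc, mul_one, Real.norm_eq_abs]; linarith
  have e : t * f b - (1 - t) * f c = t * (f b - f c) + (2 * t - 1) * f c := by ring
  calc _ ≤ |t * (f b - f c)| + |(2 * t - 1) * f c| := by rw [e]; exact abs_add_le _ _
    _ ≤ t * (K * ‖b - c‖) + D * K := by
      rw [abs_mul, abs_mul, abs_of_nonneg ht0]
      exact add_le_add (mul_le_mul_of_nonneg_left (hlip b c hb hc) ht0)
        (mul_le_mul h1 (hbd c hc) (abs_nonneg _) (norm_nonneg _))
    _ ≤ _ := by nlinarith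

/-! ### Uniform separation of pairs of Hessians -/

/-- Any two of the Hessians of `w24 δ` on a 21-dimensional subspace are separated by an elliptic
matrix with uniform constant. -/
theorem exists_isEllipticMatrix_w24Matrix (δ : ℝ) (hδ₀ : 0 ≤ δ) (hδ₂ : δ < 2)
    (H : Submodule ℝ R24) (hH : Module.finrank ℝ H = 21)
    (e : EuclideanSpace ℝ (Fin 21) ≃ₗᵢ[ℝ] H) :
    ∃ C : ℝ, 0 < C ∧ ∀ b c : R24, b ≠ 0 → c ≠ 0 → ∃ A, IsEllipticMatrix C A ∧
      0 ≤ matrixPairing A (w24Matrix δ (H.subtype ∘ₗ e.toLinearEquiv.toLinearMap) b) ∧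
      matrixPairing A (w24Matrix δ (H.subtype ∘ₗ e.toLinearEquiv.toLinearMap) c) ≤ 0 := by
  set J : EuclideanSpace ℝ (Fin 21) →ₗ[ℝ] R24 := H.subtype ∘ₗ e.toLinearEquiv.toLinearMap with hJ
  obtain ⟨K, hK0, hlip, hbd⟩ := exists_lipschitz_on_sphere
    (f := fun x => (w24Matrix δ J x).trace) (by
      unfold Matrix.trace
      exact ContDiff.sum fun i _ => contDiff_w24Form δ _ _)
  set κ := (2 - δ) * (√3)⁻¹ / 4 with hκ
  have hκ0 : 0 < κ := by
    have := mul_pos (by linarith : 0 < 2 - δ) inv_sqrt_three_pos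
    positivity
  have hk : 0 ≤ 3 * K / κ := by positivity
  refine ⟨1 + 3 * K / κ, by positivity, ?_⟩
  have hunit : ∀ b c : R24, ‖b‖ = 1 → ‖c‖ = 1 → ∃ A, IsEllipticMatrix (1 + 3 * K / κ) A ∧
      0 ≤ matrixPairing A (w24Matrix δ J b) ∧ matrixPairing A (w24Matrix δ J c) ≤ 0 := by
    intro b c hb hc
    refine exists_isEllipticMatrix_separating (by positivity) _ _ fun t ht0 ht1 => ?_
    obtain ⟨v, hvH, hv, hvt⟩ := exists_w24Form_combination_ge δ hδ₀ hδ₂ H hH b c hb hc t ht0 ht1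
    obtain ⟨ξ, hξ⟩ : ∃ ξ, J ξ = v := ⟨e.symm ⟨v, hvH⟩, by simp [hJ]⟩
    have hξn : ∑ i, ξ i ^ 2 = 1 := by
      rw [← EuclideanSpace.real_norm_sq_eq]
      have : ‖J ξ‖ = ‖ξ‖ := e.norm_map ξ
      rw [← this, hξ, hv, one_pow]
    refine ⟨_, isEllipticMatrix_one_add_smul_vecMulVec (3 * K / κ) hk (fun i => ξ i) hξn, ?_⟩
    rw [matrixPairing_sub_right, matrixPairing_smul_right, matrixPairing_smul_right,
      matrixPairing_one_add_smul_vecMulVec, matrixPairing_one_add_smul_vecMulVec,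
      sum_w24Matrix δ J b ξ, sum_w24Matrix δ J c ξ, hξ]
    have htr := (abs_le.1 (abs_combination_le_of_lipschitz hK0 hlip hbd hb hc ht0 ht1)).1
    -- The weight `3 K / κ` makes the rank-one term at least `3 K |t b - (1 - t) c|`, exactly the
    -- possible loss in the trace.
    have hmul := mul_le_mul_of_nonneg_left hvt hk
    rw [← hκ, ← mul_assoc, div_mul_cancel₀ _ hκ0.ne'] at hmul
    linarith
  intro b c hb hc
  have hnorm : ∀ x : R24, x ≠ 0 → ‖‖x‖⁻¹ • x‖ = 1 := fun x hx => by
    rw [norm_smul, norm_inv, norm_norm, inv_mul_cancel₀ (norm_ne_zero_iff.2 hx)]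
  have hscale : ∀ x : R24, x ≠ 0 →
      w24Matrix δ J x = ‖x‖ ^ 5 • w24Matrix δ J (‖x‖⁻¹ • x) := fun x hx => by
    rw [← w24Matrix_smul, smul_inv_smul₀ (norm_ne_zero_iff.2 hx)]
  obtain ⟨A, hA, h1, h2⟩ := hunit _ _ (hnorm b hb) (hnorm c hc)
  refine ⟨A, hA, ?_, ?_⟩
  · rw [hscale b hb, matrixPairing_smul_right]
    positivity
  · rw [hscale c hc, matrixPairing_smul_right]
    exact mul_nonpos_of_nonneg_of_nonpos (by positivity) h2

open Filter Topology

/-! ### Second derivatives along lines -/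

/-- `f` is differentiable near `x`, and its derivative has the derivative `c` at `x`. -/
def HasSecondDerivAt (f : ℝ → ℝ) (c x : ℝ) : Prop :=
  ∃ f' : ℝ → ℝ, (∀ᶠ s in 𝓝 x, HasDerivAt f (f' s) s) ∧ HasDerivAt f' c x

theorem HasSecondDerivAt.add {f g : ℝ → ℝ} {c d x : ℝ} (hf : HasSecondDerivAt f c x)
    (hg : HasSecondDerivAt g d x) : HasSecondDerivAt (fun s => f s + g s) (c + d) x := by
  obtain ⟨f', hf1, hf2⟩ := hf
  obtain ⟨g', hg1, hg2⟩ := hg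
  exact ⟨fun s => f' s + g' s, by filter_upwards [hf1, hg1] with s h1 h2 using h1.add h2,
    hf2.add hg2⟩

theorem HasSecondDerivAt.sub {f g : ℝ → ℝ} {c d x : ℝ} (hf : HasSecondDerivAt f c x)
    (hg : HasSecondDerivAt g d x) : HasSecondDerivAt (fun s => f s - g s) (c - d) x := by
  obtain ⟨f', hf1, hf2⟩ := hf
  obtain ⟨g', hg1, hg2⟩ := hg
  exact ⟨fun s => f' s - g' s, by filter_upwards [hf1, hg1] with s h1 h2 using h1.sub h2,
    hf2.sub hg2⟩

/-- If `c > 0`, the second derivative test makes the maximum also a local minimum, so `f` is locally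
constant and `c = 0`. -/
theorem HasSecondDerivAt.nonpos_of_isLocalMax {f : ℝ → ℝ} {c x : ℝ} (hf : HasSecondDerivAt f c x)
    (hx : IsLocalMax f x) : c ≤ 0 := by
  obtain ⟨f', h1, h2⟩ := hf
  by_contra! hc
  have hd : deriv f =ᶠ[𝓝 x] f' := by filter_upwards [h1] with s hs using hs.deriv
  have hdd : deriv (deriv f) x = c := hd.deriv_eq.trans h2.deriv
  have hmin : IsLocalMin f x := isLocalMin_of_deriv_deriv_pos (by rw [hdd]; exact hc)
    hx.deriv_eq_zero h1.self_of_nhds.continuousAt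
  have hconst : f =ᶠ[𝓝 x] fun _ => f x := by
    filter_upwards [hx, hmin] with s hs1 hs2 using le_antisymm hs1 hs2
  have hd0 : deriv f =ᶠ[𝓝 x] fun _ => 0 := by
    filter_upwards [hconst.eventuallyEq_nhds] with s hs
    rw [hs.deriv_eq, deriv_const]
  rw [hd0.deriv_eq, deriv_const] at hdd
  exact hc.ne hdd

theorem HasSecondDerivAt.le_of_isLocalMax_sub {f g : ℝ → ℝ} {c d x : ℝ}
    (hf : HasSecondDerivAt f c x) (hg : HasSecondDerivAt g d x)
    (h : IsLocalMax (fun s => f s - g s) x) : c ≤ d :=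
  sub_nonpos.1 ((hf.sub hg).nonpos_of_isLocalMax h)

theorem HasSecondDerivAt.le_of_isLocalMin_sub {f g : ℝ → ℝ} {c d x : ℝ}
    (hf : HasSecondDerivAt f c x) (hg : HasSecondDerivAt g d x)
    (h : IsLocalMin (fun s => f s - g s) x) : d ≤ c := by
  refine hg.le_of_isLocalMax_sub hf ?_
  simpa using h.neg

section Line

variable {E : Type*} [NormedAddCommGroup E] [NormedSpace ℝ E]

theorem tendsto_line (x v : E) : Tendsto (fun s : ℝ => x + s • v) (𝓝 0) (𝓝 x) := by
  have : Continuous fun s : ℝ => x + s • v := by fun_prop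
  simpa using this.tendsto 0

theorem ContDiffAt.hasSecondDerivAt_line {φ : E → ℝ} {x : E} (hφ : ContDiffAt ℝ 2 φ x) (v : E) :
    HasSecondDerivAt (fun s => φ (x + s • v)) (fderiv ℝ (fderiv ℝ φ) x v v) 0 := by
  have hline : ∀ s : ℝ, HasDerivAt (fun s : ℝ => x + s • v) v s := fun s => by
    simpa using ((hasDerivAt_id s).smul_const v).const_add x
  refine ⟨fun s => fderiv ℝ φ (x + s • v) v, ?_, ?_⟩
  · filter_upwards [(tendsto_line x v).eventually (hφ.eventually (by simp))] with s hs
    exact (hs.differentiableAt (by norm_num)).hasFDerivAt.comp_hasDerivAt s (hline s)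
  · have h1 : DifferentiableAt ℝ (fderiv ℝ φ) x :=
      (hφ.fderiv_right (m := 1) (by norm_num)).differentiableAt (by norm_num)
    have h2 : HasFDerivAt (fderiv ℝ φ) (fderiv ℝ (fderiv ℝ φ) x) (x + (0 : ℝ) • v) := by
      simpa using h1.hasFDerivAt
    exact (ContinuousLinearMap.apply ℝ ℝ v).hasFDerivAt.comp_hasDerivAt 0
      (h2.comp_hasDerivAt 0 (hline 0))

end Line

theorem sum_hessianMatrix {n : ℕ} (φ : EuclideanSpace ℝ (Fin n) → ℝ)
    (x ξ : EuclideanSpace ℝ (Fin n)) :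
    ∑ i, ∑ j, hessianMatrix φ x i j * ξ i * ξ j = fderiv ℝ (fderiv ℝ φ) x ξ ξ := by
  have key := sum_bilinear_single (LinearMap.mk₂ ℝ (fun v w => fderiv ℝ (fderiv ℝ φ) x v w)
    (by simp) (by simp) (by simp) (by simp)) ξ
  simpa only [LinearMap.mk₂_apply, hessianMatrix, Matrix.of_apply, iteratedFDeriv_two_apply,
    Matrix.cons_val_zero, Matrix.cons_val_one] using key

theorem P24_line (x v : R24) (s : ℝ) : P24 (x + s • v) =
    P24 x + s * (P24Polar x x v / 2) + s ^ 2 * (P24Polar x v v / 2) + s ^ 3 * P24 v := by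
  have h := P24Polar_self (x + s • v)
  simp only [P24Polar_add_left, P24Polar_add_mid, P24Polar_add_right, P24Polar_smul_left,
    P24Polar_smul_mid, P24Polar_smul_right] at h
  rw [P24Polar_self, P24Polar_self, P24Polar_swap_right x v x, P24Polar_swap_left v x x, P24Polar_swap_right x v x,
    P24Polar_swap_left v x v, P24Polar_swap_right v v x, P24Polar_swap_left v x v] at h
  linarith

theorem norm_sq_line (x v : R24) (s : ℝ) :
    ‖x + s • v‖ ^ 2 = inner ℝ x x + s * (2 * inner ℝ x v) + s ^ 2 * inner ℝ v v := by
  rw [← real_inner_self_eq_norm_sq]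
  simp only [inner_add_left, inner_add_right, real_inner_smul_left, real_inner_smul_right,
    real_inner_comm x v]
  ring

/-- On a line this is a cubic polynomial times a power of a quadratic one, so second derivatives are
a one-variable computation. -/
theorem w24_eq_mul_rpow (δ : ℝ) (x : R24) : w24 δ x = P24 x * (‖x‖ ^ 2) ^ (-δ / 2) := by
  rw [w24, div_eq_mul_inv, ← Real.rpow_natCast, ← Real.rpow_mul (norm_nonneg x),
    ← Real.rpow_neg (norm_nonneg x)]
  congr 2
  push_cast; ring

theorem hasSecondDerivAt_w24_line (δ : ℝ) (x v : R24) (hx : x ≠ 0) :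
    HasSecondDerivAt (fun s => w24 δ (x + s • v))
      (inner ℝ x x ^ (-δ / 2 - 2) * w24Form δ x v v) 0 := by
  obtain ⟨a, ha⟩ : ∃ a, a = -δ / 2 := ⟨_, rfl⟩
  have hN : (0 : ℝ) < inner ℝ x x := real_inner_self_pos.2 hx
  simp only [w24_eq_mul_rpow, ← ha, P24_line, norm_sq_line, w24Form]
  have hδ : δ = -2 * a := by rw [ha]; ring
  rw [hδ]
  generalize (inner ℝ x x : ℝ) = N at *
  generalize (inner ℝ x v : ℝ) = q
  generalize (inner ℝ v v : ℝ) = V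
  generalize P24 x = P
  generalize P24Polar x x v = G
  generalize P24Polar x v v = S
  generalize P24 v = T
  have hn : ∀ s, HasDerivAt (fun s : ℝ => N + s * (2 * q) + s ^ 2 * V) (2 * q + 2 * s * V) s := by
    intro s
    have h1 := ((hasDerivAt_id s).mul_const (2 * q)).const_add N
    have h2 := (hasDerivAt_pow 2 s).mul_const V
    exact (h1.add h2).congr_deriv (by norm_num)
  have hc : ∀ s, HasDerivAt
      (fun s : ℝ => P + s * (G / 2) + s ^ 2 * (S / 2) + s ^ 3 * T)
      (G / 2 + s * S + 3 * s ^ 2 * T) s := by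
    intro s
    have h1 := ((hasDerivAt_id s).mul_const (G / 2)).const_add P
    have h2 := (hasDerivAt_pow 2 s).mul_const (S / 2)
    have h3 := (hasDerivAt_pow 3 s).mul_const T
    exact ((h1.add h2).add h3).congr_deriv (by norm_num; ring)
  have hpos : ∀ᶠ s in 𝓝 (0 : ℝ), 0 < N + s * (2 * q) + s ^ 2 * V := by
    refine (hn 0).continuousAt.eventually (lt_mem_nhds ?_)
    simpa using hN
  refine ⟨fun s => (G / 2 + s * S + 3 * s ^ 2 * T) * (N + s * (2 * q) + s ^ 2 * V) ^ a
    + (P + s * (G / 2) + s ^ 2 * (S / 2) + s ^ 3 * T) *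
      ((2 * q + 2 * s * V) * a * (N + s * (2 * q) + s ^ 2 * V) ^ (a - 1)), ?_, ?_⟩
  · filter_upwards [hpos] with s hs
    exact (hc s).mul ((hn s).rpow_const (Or.inl hs.ne'))
  · have hne : N + 0 * (2 * q) + 0 ^ 2 * V ≠ 0 := by simpa using hN.ne'
    have hc' : HasDerivAt (fun s : ℝ => G / 2 + s * S + 3 * s ^ 2 * T) S 0 := by
      have h1 := ((hasDerivAt_id (0 : ℝ)).mul_const S).const_add (G / 2)
      have h2 := ((hasDerivAt_pow 2 (0 : ℝ)).const_mul 3).mul_const T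
      exact (h1.add h2).congr_deriv (by norm_num)
    have hn' : HasDerivAt (fun s : ℝ => (2 * q + 2 * s * V) * a) (2 * V * a) 0 := by
      have h1 := ((((hasDerivAt_id (0 : ℝ)).const_mul 2).mul_const V).const_add (2 * q)).mul_const a
      exact h1.congr_deriv (by norm_num)
    have := (hc'.mul ((hn 0).rpow_const (p := a) (Or.inl hne))).add
      ((hc 0).mul (hn'.mul ((hn 0).rpow_const (p := a - 1) (Or.inl hne))))
    refine this.congr_deriv ?_
    have e1 : N ^ a = N ^ (a - 2) * N ^ 2 := by
      rw [← Real.rpow_natCast, ← Real.rpow_add hN]; norm_num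
    have e2 : N ^ (a - 1) = N ^ (a - 2) * N := by
      rw [← Real.rpow_add_one hN.ne']; congr 1; ring
    have e3 : a - 1 - 1 = a - 2 := by ring
    have e0 : N + 0 * (2 * q) + 0 ^ 2 * V = N := by ring
    simp only [Pi.mul_apply, e0, e3, e1, e2]
    ring

/-! ### Continuity -/

theorem abs_P24_le_norm_pow (x : R24) : |P24 x| ≤ ‖x‖ ^ 3 := by
  have h := abs_two_mul_P24_le x
  have h1 := firstNorm_le x
  have h0 := firstNorm_nonneg x
  have hn := norm_nonneg x
  rw [abs_mul, abs_two] at h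
  have h2 : firstNorm x * (‖x‖ ^ 2 - firstNorm x ^ 2) ≤ ‖x‖ * ‖x‖ ^ 2 := by
    apply mul_le_mul h1 (by nlinarith) (by nlinarith) hn
  have : 0 ≤ ‖x‖ ^ 3 := by positivity
  nlinarith

theorem w24_zero (δ : ℝ) : w24 δ 0 = 0 := by
  have : P24 0 = 0 := by simpa using abs_P24_le_norm_pow 0
  rw [w24, this, zero_div]

theorem w24_neg (δ : ℝ) (x : R24) : w24 δ (-x) = -w24 δ x := by
  rw [w24, w24, P24_neg, norm_neg, neg_div]

theorem continuous_w24 (δ : ℝ) (hδ : δ < 3) : Continuous (w24 δ) := by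
  rw [continuous_iff_continuousAt]
  intro x
  rcases eq_or_ne x 0 with rfl | hx
  · have hbd : ∀ x : R24, ‖w24 δ x‖ ≤ ‖x‖ ^ (3 - δ) := by
      intro x
      rcases eq_or_ne x 0 with rfl | hx
      · rw [w24_zero, norm_zero]; positivity
      · have hpos := norm_pos_iff.2 hx
        rw [w24, norm_div, Real.norm_eq_abs, Real.norm_of_nonneg (by positivity),
          Real.rpow_sub hpos]
        refine div_le_div_of_nonneg_right ?_ (by positivity)
        exact_mod_cast abs_P24_le_norm_pow x
    rw [ContinuousAt, w24_zero]
    refine squeeze_zero_norm hbd ?_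
    have : Continuous fun x : R24 => ‖x‖ ^ (3 - δ) :=
      continuous_norm.rpow_const fun _ => Or.inr (by linarith)
    simpa [Real.zero_rpow (by linarith : 3 - δ ≠ 0)] using this.tendsto 0
  · exact contDiff_P24.continuous.continuousAt.div
      (continuous_norm.continuousAt.rpow_const (Or.inl (norm_ne_zero_iff.2 hx)))
      (Real.rpow_pos_of_pos (norm_pos_iff.2 hx) _).ne'

/-! ### Isaacs operators -/

section Isaacs

variable {n : ℕ} {𝓐 𝓑 : Type} {A : 𝓐 → 𝓑 → Matrix (Fin n) (Fin n) ℝ}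
  {C : ℝ} {M : Matrix (Fin n) (Fin n) ℝ}

theorem isaacsOperator_nonneg [Nonempty 𝓐] (hC : 0 < C) (hA : ∀ a b, IsEllipticMatrix C (A a b)) (b : 𝓑)
    (h : ∀ a, 0 ≤ matrixPairing (A a b) M) : 0 ≤ isaacsOperator A M := by
  -- Uniform ellipticity bounds the families; without bounds, real suprema and infima take default
  -- values.
  have hbd := fun a b => abs_le.1 ((hA a b).abs_matrixPairing_le hC M)
  obtain ⟨a₀⟩ := ‹Nonempty 𝓐›
  have hinf : ∀ b, BddBelow (Set.range fun a => matrixPairing (A a b) M) := fun b =>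
    ⟨_, by rintro _ ⟨a, rfl⟩; exact (hbd a b).1⟩
  have hsup : BddAbove (Set.range fun b => ⨅ a, matrixPairing (A a b) M) :=
    ⟨_, by rintro _ ⟨b, rfl⟩; exact (ciInf_le (hinf b) a₀).trans (hbd a₀ b).2⟩
  have : Nonempty 𝓐 := ⟨a₀⟩
  exact le_ciSup_of_le hsup b (le_ciInf h)

theorem isaacsOperator_nonpos [Nonempty 𝓑] (hC : 0 < C) (hA : ∀ a b, IsEllipticMatrix C (A a b))
    (h : ∀ b, ∃ a, matrixPairing (A a b) M ≤ 0) : isaacsOperator A M ≤ 0 := by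
  have hbd := fun a b => abs_le.1 ((hA a b).abs_matrixPairing_le hC M)
  refine ciSup_le fun b => ?_
  obtain ⟨a, ha⟩ := h b
  exact ciInf_le_of_le ⟨_, by rintro _ ⟨a, rfl⟩; exact (hbd a b).1⟩ a ha

end Isaacs

theorem IsEllipticMatrix.matrixPairing_le_of_forall {n : ℕ} {C : ℝ}
    {A M N : Matrix (Fin n) (Fin n) ℝ} (hC : 0 < C) (hA : IsEllipticMatrix C A)
    (h : ∀ ξ : EuclideanSpace ℝ (Fin n),
      ∑ i, ∑ j, M i j * ξ i * ξ j ≤ ∑ i, ∑ j, N i j * ξ i * ξ j) :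
    matrixPairing A M ≤ matrixPairing A N := by
  rw [← sub_nonneg, ← matrixPairing_sub_right]
  refine matrixPairing_nonneg (hA.posSemidef hC) fun ξ => ?_
  simp only [Matrix.sub_apply, sub_mul, Finset.sum_sub_distrib]
  exact sub_nonneg.2 (h (WithLp.toLp 2 ξ))

theorem matrixPairing_zero_right {n : ℕ} (A : Matrix (Fin n) (Fin n) ℝ) :
    matrixPairing A 0 = 0 := by
  simp [matrixPairing]

/-! ### Test functions touching an odd function at the origin -/

section Odd

variable {E : Type*} [NormedAddCommGroup E] [NormedSpace ℝ E]

theorem isLocalExtr_line {f : E → ℝ} {x : E} (v : E) :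
    (IsLocalMax f x → IsLocalMax (fun s : ℝ => f (x + s • v)) 0) ∧
      (IsLocalMin f x → IsLocalMin (fun s : ℝ => f (x + s • v)) 0) := by
  constructor <;> intro h <;>
  · have := (tendsto_line x v).eventually h
    filter_upwards [this] with s hs
    simpa using hs

theorem hasSecondDerivAt_const (c x : ℝ) : HasSecondDerivAt (fun _ => c) 0 x :=
  ⟨fun _ => 0, Eventually.of_forall fun s => hasDerivAt_const s c, hasDerivAt_const x 0⟩

/-- Adding the inequalities at `s v` and `-s v` cancels `u`, so the even part of `φ` has a local
minimum along each line, whether or not `u` is twice differentiable at `0`. -/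
theorem fderiv_fderiv_nonneg_of_odd {u φ : E → ℝ} (hu : ∀ x, u (-x) = -u x)
    (hφ : ContDiffAt ℝ 2 φ 0) (h : IsLocalMax (fun x => u x - φ x) 0) (v : E) :
    0 ≤ fderiv ℝ (fderiv ℝ φ) 0 v v := by
  have hu0 : u 0 = 0 := by
    have := hu 0
    rw [neg_zero] at this
    linarith
  have h1 := (hφ.hasSecondDerivAt_line v).add (hφ.hasSecondDerivAt_line (-v))
  have h2 := (isLocalExtr_line v).1 h
  have h3 := (isLocalExtr_line (-v)).1 h
  have h4 : IsLocalMax (fun s : ℝ => 0 - (φ (0 + s • v) + φ (0 + s • -v))) 0 := by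
    filter_upwards [h2, h3] with s hs1 hs2
    simp only [zero_add, zero_smul, smul_neg, hu, hu0] at hs1 hs2 ⊢
    linarith
  have := (hasSecondDerivAt_const 0 0).le_of_isLocalMax_sub h1 h4
  simp only [map_neg, neg_apply, neg_neg] at this
  linarith

theorem fderiv_fderiv_nonpos_of_odd {u φ : E → ℝ} (hu : ∀ x, u (-x) = -u x)
    (hφ : ContDiffAt ℝ 2 φ 0) (h : IsLocalMin (fun x => u x - φ x) 0) (v : E) :
    fderiv ℝ (fderiv ℝ φ) 0 v v ≤ 0 := by
  have hu0 : u 0 = 0 := by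
    have := hu 0
    rw [neg_zero] at this
    linarith
  have h1 := (hφ.hasSecondDerivAt_line v).add (hφ.hasSecondDerivAt_line (-v))
  have h2 := (isLocalExtr_line v).2 h
  have h3 := (isLocalExtr_line (-v)).2 h
  have h4 : IsLocalMin (fun s : ℝ => 0 - (φ (0 + s • v) + φ (0 + s • -v))) 0 := by
    filter_upwards [h2, h3] with s hs1 hs2
    simp only [zero_add, zero_smul, smul_neg, hu, hu0] at hs1 hs2 ⊢
    linarith
  have := (hasSecondDerivAt_const 0 0).le_of_isLocalMin_sub h1 h4
  simp only [map_neg, neg_apply, neg_neg] at this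
  linarith

end Odd

/-! ### The Isaacs equation -/

theorem theorem1p2 (δ : ℝ) (hδ₁ : 1 ≤ δ) (hδ₂ : δ < 2)
    (H : Submodule ℝ R24) (hH : Module.finrank ℝ H = 21)
    (e : EuclideanSpace ℝ (Fin 21) ≃ₗᵢ[ℝ] H) :
    SolvesUniformlyEllipticIsaacs (Metric.ball (0 : EuclideanSpace ℝ (Fin 21)) 1)
      (fun y => w24 δ (e y : R24)) := by
  obtain ⟨C, hC, hsep⟩ := exists_isEllipticMatrix_w24Matrix δ (by linarith) hδ₂ H hH e
  set J : EuclideanSpace ℝ (Fin 21) →ₗ[ℝ] R24 := H.subtype ∘ₗ e.toLinearEquiv.toLinearMap with hJ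
  have hJe : ∀ y, ((e y : H) : R24) = J y := fun _ => rfl
  have hJ0 : ∀ y, y ≠ 0 → J y ≠ 0 := fun y hy h => hy (by
    have h1 : ‖y‖ = ‖J y‖ := (e.norm_map y).symm
    rw [h, norm_zero] at h1
    exact norm_eq_zero.1 h1)
  choose A hA hAb hAc using hsep
  have hne : Nonempty {x : R24 // x ≠ 0} :=
    ⟨⟨J (EuclideanSpace.single 0 1), hJ0 _ (by simp)⟩⟩
  -- The supremum index takes the slot of nonnegative pairing and the infimum index that of
  -- nonpositive pairing.
  refine ⟨{x : R24 // x ≠ 0}, {x : R24 // x ≠ 0}, hne, hne,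
    fun a b => A b.1 a.1 b.2 a.2, C, hC, fun a b => hA _ _ _ _, ?_, ?_⟩
  · exact ((continuous_w24 δ (by linarith)).comp
      (continuous_subtype_val.comp e.continuous)).continuousOn
  · intro x₀ hx₀ φ hφ
    have hφ' : ContDiffAt ℝ 2 φ x₀ := hφ.contDiffAt (Metric.isOpen_ball.mem_nhds hx₀)
    simp only [hJe]
    rcases eq_or_ne x₀ 0 with rfl | hx
    · have hodd : ∀ y, w24 δ (J (-y)) = -w24 δ (J y) := fun y => by rw [map_neg, w24_neg]
      obtain ⟨b⟩ := id hne
      constructor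
      · intro h
        refine isaacsOperator_nonneg hC (fun a b => hA _ _ _ _) b fun a => ?_
        rw [← matrixPairing_zero_right (A b.1 a.1 b.2 a.2)]
        refine (hA _ _ _ _).matrixPairing_le_of_forall hC fun ξ => ?_
        rw [sum_hessianMatrix]
        simpa using fderiv_fderiv_nonneg_of_odd hodd hφ' h ξ
      · intro h
        refine isaacsOperator_nonpos hC (fun a b => hA _ _ _ _) fun a => ⟨b, ?_⟩
        rw [← matrixPairing_zero_right (A a.1 b.1 a.2 b.2)]
        refine (hA _ _ _ _).matrixPairing_le_of_forall hC fun ξ => ?_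
        rw [sum_hessianMatrix]
        simpa using fderiv_fderiv_nonpos_of_odd hodd hφ' h ξ
    · have hX := hJ0 x₀ hx
      set k : ℝ := inner ℝ (J x₀) (J x₀) ^ (-δ / 2 - 2) with hk
      have hk0 : 0 ≤ k := Real.rpow_nonneg real_inner_self_nonneg _
      have hline : ∀ ξ, HasSecondDerivAt (fun s => w24 δ (J (x₀ + s • ξ)))
          (∑ i, ∑ j, (k • w24Matrix δ J (J x₀)) i j * ξ i * ξ j) 0 := by
        intro ξ
        have := hasSecondDerivAt_w24_line δ (J x₀) (J ξ) hX
        rw [← sum_w24Matrix, ← hk] at this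
        simpa only [map_add, map_smul, Matrix.smul_apply, smul_eq_mul, Finset.mul_sum, mul_assoc]
          using this
      constructor
      · intro h
        -- The supremum index is the contact point itself: every matrix in its row pairs
        -- nonnegatively with the Hessian of `u` there, which lies below that of `φ`.
        refine isaacsOperator_nonneg hC (fun a b => hA _ _ _ _) ⟨J x₀, hX⟩ fun a => ?_
        refine le_trans ?_ ((hA _ _ _ _).matrixPairing_le_of_forall hC
          (M := k • w24Matrix δ J (J x₀)) fun ξ => ?_)
        · rw [matrixPairing_smul_right]
          exact mul_nonneg hk0 (hAb _ _ _ _)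
        · rw [sum_hessianMatrix]
          exact (hline ξ).le_of_isLocalMax_sub (hφ'.hasSecondDerivAt_line ξ)
            ((isLocalExtr_line ξ).1 h)
      · intro h
        -- Dually, the contact point answers every `b` as infimum index.
        refine isaacsOperator_nonpos hC (fun a b => hA _ _ _ _) fun b => ⟨⟨J x₀, hX⟩, ?_⟩
        refine le_trans ((hA _ _ _ _).matrixPairing_le_of_forall hC
          (N := k • w24Matrix δ J (J x₀)) fun ξ => ?_) ?_
        · rw [sum_hessianMatrix]
          exact (hline ξ).le_of_isLocalMin_sub (hφ'.hasSecondDerivAt_line ξ)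
            ((isLocalExtr_line ξ).2 h)
        · rw [matrixPairing_smul_right]
          exact mul_nonpos_of_nonneg_of_nonpos hk0 (hAc _ _ _ _)
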